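/- **Setting.** A source transmits to one receiver over $N$ slots, indexed backwards by $n=N,N-1,\dots,1$ ($n$ is the number of slots remaining). At the beginning of slot $n$ the state is $(X_n,S_n)$, where $X_n\ge 0$ is the receiver's buffer level and $S_n\in\mathcal S$ is the channel condition; $\mathcal S$ is finite, and the channel conditions are independent and identically distributed from slot to slot, with $p(s)=\Pr(S_n=s)$. The scheduler transmits $Z_n$ (real-valued) packets, and $X_{n-1}=X_n+Z_n-d$ with $d>0$. Transmitting $z$ packets in condition $s$ consumes the power $$c(z,s)=z\,\tilde c_0(s)+\sum_{k=0}^{K-1}\bigl(\tilde c_{k+1}(s)-\tilde c_k(s)\bigr)\max\{z-\tilde z_k(s),0\},$$ where $0<\tilde c_0(s)\le\dots\le\tilde c_K(s)$ and $0=:\tilde z_{-1}(s)<\tilde z_0(s)<\dots<\tilde z_{K-1}(s)<\tilde z_{\max}(s)$, and $\tilde z_{\max}(s)$ is defined by $c(\tilde z_{\max}(s),s)=P$; assume $\tilde z_{\max}(s)\ge d$ for all $s$. The holding cost is linear, $h(x)=h\cdot x$ with $h\ge0$, and $0\le\alpha\le1$. Problem (P1) is to minimize, over all history-dependent randomized policies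 satisfying $Z_n\ge\max\{0,d-X_n\}$ and $c(Z_n,S_n)\le P$ with probability one for all $n$, the expected cost, given the initial state $(X_N,S_N)=(x,s)$, $$\mathbb E^\pi\Bigl[\sum_{n=1}^{N}\alpha^{N-n}\bigl\{c(Z_n,S_n)+h\cdot(X_n+Z_n-d)\bigr\}\Bigr].$$ Assume finally that for every $s$ the numbers $\tilde L_k(s):=\tilde z_k(s)/d$ ($0\le k\le K-1$) and $\tilde L_{\max}(s):=\tilde z_{\max}(s)/d$ are positive integers, and put $\tilde L_{-1}(s):=0$. **Thresholds.** For $n\ge1$ and $j\ge1$ define $\tilde\gamma_{n,j}$ recursively: $\tilde\gamma_{n,j}=\infty$ if $j=1$; $\tilde\gamma_{n,j}=0$ if $j>n$; and, if $2\le j\le n$, $$\tilde\gamma_{n,j}=-h+\alpha\Biggl(\sum_{s:\ \tilde c_0(s)\ge\tilde\gamma_{n-1,j-1}}p(s)\,\tilde\gamma_{n-1,j-1}+\sum_{k=0}^{K-1}\Bigl\{\sum_{s:\ \tilde\gamma_{n-1,j-1+\tilde L_k(s)}\le\tilde c_k(s)<\tilde\gamma_{n-1,j-1+\tilde L_{k-1}(s)}}p(s)\,\tilde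 c_k(s)+\sum_{s:\ \tilde c_k(s)<\tilde\gamma_{n-1,j-1+\tilde L_k(s)}\le\tilde c_{k+1}(s)}p(s)\,\tilde\gamma_{n-1,j-1+\tilde L_k(s)}\Bigr\}$$ $$\qquad+\sum_{s:\ \tilde\gamma_{n-1,j-1+\tilde L_{\max}(s)}\le\tilde c_K(s)<\tilde\gamma_{n-1,j-1+\tilde L_{K-1}(s)}}p(s)\,\tilde c_K(s)+\sum_{s:\ \tilde c_K(s)<\tilde\gamma_{n-1,j-1+\tilde L_{\max}(s)}}p(s)\,\tilde\gamma_{n-1,j-1+\tilde L_{\max}(s)}\Biggr).$$ **Theorem.** 1. For all $n\ge1$, $s\in\mathcal S$ and $0\le k\le K$ there is exactly one integer $j\ge1$ with $\tilde\gamma_{n,j+1}\le\tilde c_k(s)<\tilde\gamma_{n,j}$. Put $b_{n,k}(s):=j\cdot d$ for this $j$, and $b_{n,-1}(s):=\infty$. Then $b_{n,k}(s)$ is nonincreasing in $k$. 2. For all $n\ge 1$, $s\in\mathcal S$ and $x\ge0$ the prescription $$z_n^*(x,s)=\begin{cases}\tilde z_{k-1}(s)&\text{if } b_{n,k}(s)-\tilde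 z_{k-1}(s)<x\le b_{n,k-1}(s)-\tilde z_{k-1}(s),\ 0\le k\le K,\\ b_{n,k}(s)-x&\text{if } b_{n,k}(s)-\tilde z_k(s)<x\le b_{n,k}(s)-\tilde z_{k-1}(s),\ 0\le k\le K-1,\\ b_{n,K}(s)-x&\text{if } b_{n,K}(s)-\tilde z_{\max}(s)<x\le b_{n,K}(s)-\tilde z_{K-1}(s),\\ \tilde z_{\max}(s)&\text{if } 0\le x\le b_{n,K}(s)-\tilde z_{\max}(s)\end{cases}$$ determines exactly one value, and for every $N$ the (finite generalized base-stock) policy that transmits $z_n^*(x,s)$ packets in slot $n$ in state $(x,s)$ is feasible and optimal for Problem (P1), from every initial state $(x,s)$ with $x\ge0$ (in particular from the empty buffer $x=0$). 3. If $K=0$ (linear power-rate curves $c(z,s)=c_s z$ with $c_s=\tilde c_0(s)$), then $\tilde\gamma_{n,j}=\gamma_{n,j}$ for all $n,j\ge1$, where $\gamma_{n,j}=\infty$ if $j=1$, $\gamma_{n,j}=0$ if $j>n$, and, if $2\le j\le n$, with $L(s)=\frac{P}{d\,c_s}$, $$\gamma_{n,j}=-h+\alpha\Bigl(\sum_{s:\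 c_s\ge\gamma_{n-1,j-1}}p(s)\gamma_{n-1,j-1}+\sum_{s:\ c_s<\gamma_{n-1,j-1}}p(s)c_s+\sum_{s:\ c_s<\gamma_{n-1,j-1+L(s)}}p(s)\bigl[\gamma_{n-1,j-1+L(s)}-c_s\bigr]\Bigr);$$ and with $b_n(s)=b_{n,0}(s)$, $z^*_n(x,s)$ equals $0$ if $x\ge b_n(s)$, $b_n(s)-x$ if $b_n(s)-\frac P{c_s}\le x<b_n(s)$, and $\frac P{c_s}$ if $x<b_n(s)-\frac P{c_s}$. -/

import Mathlib

open MeasureTheory ProbabilityTheory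
open scoped ENNReal

/-- The piecewise-linear power-rate function with `K + 1` segments, slopes `slope 0, …, slope K`
and breakpoints `brk 0, …, brk (K - 1)` (the entries outside these ranges are not used). -/
noncomputable def pwlRate (K : ℕ) (slope brk : ℕ → ℝ) (z : ℝ) : ℝ :=
  z * slope 0 + ∑ k ∈ Finset.range K, (slope (k + 1) - slope k) * max (z - brk k) 0

/-- A single-receiver transmission model with an IID channel taking values in `S`, a linear
holding cost `x ↦ h * x`, and piecewise-linear convex power-rate curves with `K + 1` segments. -/
structure TxModel (S : Type*) where
  /-- number of segments of each power-rate curve, minus one -/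
  K : ℕ
  /-- slope of the segment `k ≤ K` in channel condition `s` -/
  slope : ℕ → S → ℝ
  /-- the `k`-th point, `k < K`, at which the slope changes in channel condition `s` -/
  brk : ℕ → S → ℝ
  /-- power available in one slot -/
  P : ℝ
  /-- number of packets played out in one slot -/
  d : ℝ
  /-- holding cost per packet and slot -/
  h : ℝ
  /-- discount factor -/
  α : ℝ
  /-- distribution of the channel condition in a slot -/
  p : PMF S
  /-- the number of packets whose transmission consumes exactly the power `P` -/
  zMax : S → ℝ
  slope_pos : ∀ s, 0 < slope 0 s
  slope_mono : ∀ s k, k < K → slope k s ≤ slope (k + 1) s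
  brk_pos : ∀ s k, k < K → 0 < brk k s
  brk_lt : ∀ s k, k + 1 < K → brk k s < brk (k + 1) s
  rate_zMax : ∀ s, pwlRate K (fun k => slope k s) (fun k => brk k s) (zMax s) = P
  brk_lt_zMax : ∀ s k, k < K → brk k s < zMax s
  d_pos : 0 < d
  d_le_zMax : ∀ s, d ≤ zMax s
  h_nonneg : 0 ≤ h
  α_nonneg : 0 ≤ α
  α_le_one : α ≤ 1

/-! ### The controlled process -/

/-- What is recorded in one slot: the state (buffer level, channel condition) at the beginning of
the slot, and the number of packets transmitted. -/
abbrev TxSlot (S : Type*) := (ℝ × S) × ℝ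

/-- A history-dependent randomized transmission policy. The slots are numbered forward,
`t = 0, 1, …`; in slot `t` the policy draws the number of packets to transmit from a distribution
that depends on the states and actions of all earlier slots and on the current state. -/
structure TxPolicy (S : Type*) [MeasurableSpace S] where
  act : (t : ℕ) → Kernel ((Fin t → TxSlot S) × (ℝ × S)) ℝ
  markov : ∀ t, IsMarkovKernel (act t)

namespace TxModel

variable {S : Type*}

/-- Power consumed by transmitting `z` packets in channel condition `s`. -/
noncomputable def rate (M : TxModel S) (z : ℝ) (s : S) : ℝ :=
  pwlRate M.K (fun k => M.slope k s) (fun k => M.brk k s) z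

/-- The law of the state at the beginning of slot `t` given the records of the earlier slots,
when the initial state is `(x, s)`: the buffer level moves from `X` to `X + Z - d`, and a new
channel condition is drawn independently of the past. -/
noncomputable def stateKernel (M : TxModel S) [MeasurableSpace S] (x : ℝ) (s : S) :
    (t : ℕ) → Kernel (Fin t → TxSlot S) (ℝ × S)
  | 0 => Kernel.const _ (Measure.dirac (x, s))
  | t + 1 =>
      (Kernel.deterministic
        (fun ω : Fin (t + 1) → TxSlot S => (ω (Fin.last t)).1.1 + (ω (Fin.last t)).2 - M.d)
        (by fun_prop)) ×ₖ Kernel.const _ M.p.toMeasure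

/-- The law of the records of the first `t` slots under the policy `π`, when the initial state is
`(x, s)`. -/
noncomputable def law (M : TxModel S) [MeasurableSpace S] (π : TxPolicy S) (x : ℝ) (s : S) :
    (t : ℕ) → Measure (Fin t → TxSlot S)
  | 0 => Measure.dirac Fin.elim0
  | t + 1 =>
      ((M.law π x s t ⊗ₘ M.stateKernel x s t) ⊗ₘ π.act t).map
        (fun q => Fin.snoc (α := fun _ => TxSlot S) q.1.1 (q.1.2, q.2))

instance isMarkovKernel_stateKernel [MeasurableSpace S] (M : TxModel S) (x : ℝ) (s : S) (t : ℕ) :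
    IsMarkovKernel (M.stateKernel x s t) := by
  cases t <;> unfold stateKernel <;> infer_instance

instance isProbabilityMeasure_law [MeasurableSpace S] (M : TxModel S) (π : TxPolicy S)
    (x : ℝ) (s : S) (t : ℕ) : IsProbabilityMeasure (M.law π x s t) := by
  induction t with
  | zero => unfold law; infer_instance
  | succ t ih =>
    have := π.markov t
    unfold law
    refine Measure.isProbabilityMeasure_map (Measurable.aemeasurable ?_)
    refine measurable_pi_iff.2 fun i => ?_
    refine Fin.lastCases ?_ (fun i => ?_) i
    · simp only [Fin.snoc_last]; fun_prop
    · simp only [Fin.snoc_castSucc]; fun_prop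

/-- The underflow constraint, the nonnegativity constraint and the power constraint hold with
probability one in each of the `N` slots, when the initial state is `(x, s)`. -/
def Feasible (M : TxModel S) [MeasurableSpace S] (N : ℕ) (π : TxPolicy S) (x : ℝ) (s : S) : Prop :=
  ∀ᵐ ω ∂(M.law π x s N), ∀ i : Fin N,
    max 0 (M.d - (ω i).1.1) ≤ (ω i).2 ∧ M.rate (ω i).2 (ω i).1.2 ≤ M.P

/-- The expected discounted cost over `N` slots, when the initial state is `(x, s)`. -/
noncomputable def cost (M : TxModel S) [MeasurableSpace S] (N : ℕ) (π : TxPolicy S) (x : ℝ) (s : S) : ℝ :=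
  ∫ ω, ∑ i : Fin N, M.α ^ (i : ℕ) *
    (M.rate (ω i).2 (ω i).1.2 + M.h * ((ω i).1.1 + (ω i).2 - M.d)) ∂(M.law π x s N)

/-- The policy `π` solves the `N`-slot problem: for each initial state it is feasible and no
feasible history-dependent randomized policy has a smaller expected cost. -/
def IsOptimal (M : TxModel S) [MeasurableSpace S] (N : ℕ) (π : TxPolicy S) : Prop :=
  ∀ (x : ℝ) (s : S), 0 ≤ x → M.Feasible N π x s ∧
    ∀ π' : TxPolicy S, M.Feasible N π' x s → M.cost N π x s ≤ M.cost N π' x s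

/-! ### Thresholds and critical numbers -/

/-- The breakpoint with index `k - 1`; the one with index `-1` is `0`. -/
def brkPrev (M : TxModel S) : ℕ → S → ℝ
  | 0, _ => 0
  | k + 1, s => M.brk k s

/-- The breakpoint with index `k`, measured in multiples of `d`. -/
noncomputable def L (M : TxModel S) (k : ℕ) (s : S) : ℕ := ⌊M.brk k s / M.d⌋₊

/-- The breakpoint with index `k - 1`, measured in multiples of `d`. -/
noncomputable def LPrev (M : TxModel S) (k : ℕ) (s : S) : ℕ := ⌊M.brkPrev k s / M.d⌋₊

/-- The maximal number of packets, measured in multiples of `d`. -/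
noncomputable def LMax (M : TxModel S) (s : S) : ℕ := ⌊M.zMax s / M.d⌋₊

open Classical in
/-- The threshold with `n ≥ 1` slots remaining and index `j ≥ 1` (the values at `n = 0` and at
`j = 0` are not used). Only thresholds with `j = 1` are infinite, and they are never summed: the
conditions under the sums select real thresholds. -/
noncomputable def gamma (M : TxModel S) [Fintype S] : ℕ → ℕ → EReal
  | 0, _ => 0
  | n + 1, j =>
    if j = 1 then ⊤
    else if n + 1 < j then 0
    else
      ((-M.h + M.α *
        ((∑ s with M.gamma n (j - 1) ≤ (M.slope 0 s : EReal),
            (M.p s).toReal * (M.gamma n (j - 1)).toReal)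
        + (∑ k ∈ Finset.range M.K,
            ((∑ s with M.gamma n (j - 1 + M.L k s) ≤ (M.slope k s : EReal) ∧
                  (M.slope k s : EReal) < M.gamma n (j - 1 + M.LPrev k s),
                (M.p s).toReal * M.slope k s)
            + ∑ s with (M.slope k s : EReal) < M.gamma n (j - 1 + M.L k s) ∧
                  M.gamma n (j - 1 + M.L k s) ≤ (M.slope (k + 1) s : EReal),
                (M.p s).toReal * (M.gamma n (j - 1 + M.L k s)).toReal))
        + (∑ s with M.gamma n (j - 1 + M.LMax s) ≤ (M.slope M.K s : EReal) ∧
                (M.slope M.K s : EReal) < M.gamma n (j - 1 + M.LPrev M.K s),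
              (M.p s).toReal * M.slope M.K s)
        + ∑ s with (M.slope M.K s : EReal) < M.gamma n (j - 1 + M.LMax s),
              (M.p s).toReal * (M.gamma n (j - 1 + M.LMax s)).toReal) : ℝ) : EReal)

/-- The slope `k` in channel condition `s` lies between the thresholds `j + 1` and `j`. -/
def InBand (M : TxModel S) [Fintype S] (n k : ℕ) (s : S) (j : ℕ) : Prop :=
  1 ≤ j ∧ M.gamma n (j + 1) ≤ (M.slope k s : EReal) ∧ (M.slope k s : EReal) < M.gamma n j

/-- The critical number of segment `k`: it is `j * d` for the index `j` of the band of thresholds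
that contains the slope. -/
noncomputable def crit (M : TxModel S) [Fintype S] (n k : ℕ) (s : S) : ℝ :=
  (sInf {j : ℕ | M.InBand n k s j} : ℕ) * M.d

/-- `z` is the number of packets that the finite generalized base-stock policy with the critical
numbers `crit n k s` transmits in state `(x, s)` with `n` slots remaining. In the first case the
upper bound on `x` is absent for `k = 0`, where the preceding critical number is infinite. -/
def BaseStock (M : TxModel S) [Fintype S] (n : ℕ) (x : ℝ) (s : S) (z : ℝ) : Prop :=
  (∃ k ≤ M.K, M.crit n k s - M.brkPrev k s < x ∧
      (1 ≤ k → x ≤ M.crit n (k - 1) s - M.brkPrev k s) ∧ z = M.brkPrev k s) ∨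
  (∃ k < M.K, M.crit n k s - M.brk k s < x ∧ x ≤ M.crit n k s - M.brkPrev k s ∧
      z = M.crit n k s - x) ∨
  (M.crit n M.K s - M.zMax s < x ∧ x ≤ M.crit n M.K s - M.brkPrev M.K s ∧
      z = M.crit n M.K s - x) ∨
  (0 ≤ x ∧ x ≤ M.crit n M.K s - M.zMax s ∧ z = M.zMax s)

/-- In each of the `N` slots and each state with a nonnegative buffer level the policy transmits,
with probability one, the number of packets of the finite generalized base-stock policy. In the
forward numbering, `N - t` slots are remaining in slot `t`. -/
def FollowsBaseStock (M : TxModel S) [Fintype S] [MeasurableSpace S] (N : ℕ) (π : TxPolicy S) : Prop :=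
  ∀ t < N, ∀ (ω : Fin t → TxSlot S) (x : ℝ) (s : S) (z : ℝ), 0 ≤ x →
    M.BaseStock (N - t) x s z → π.act t (ω, (x, s)) = Measure.dirac z

open Classical in
/-- The thresholds for linear power-rate curves with slope `slope 0 s` (again for `n ≥ 1` and
`j ≥ 1`); here `P / slope 0 s` packets can be transmitted in one slot. -/
noncomputable def gammaLin (M : TxModel S) [Fintype S] : ℕ → ℕ → EReal
  | 0, _ => 0
  | n + 1, j =>
    if j = 1 then ⊤
    else if n + 1 < j then 0
    else
      ((-M.h + M.α *
        ((∑ s with M.gammaLin n (j - 1) ≤ (M.slope 0 s : EReal),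
            (M.p s).toReal * (M.gammaLin n (j - 1)).toReal)
        + (∑ s with (M.slope 0 s : EReal) < M.gammaLin n (j - 1),
            (M.p s).toReal * M.slope 0 s)
        + ∑ s with (M.slope 0 s : EReal) <
              M.gammaLin n (j - 1 + ⌊M.P / (M.d * M.slope 0 s)⌋₊),
            (M.p s).toReal *
              ((M.gammaLin n (j - 1 + ⌊M.P / (M.d * M.slope 0 s)⌋₊)).toReal
                - M.slope 0 s)) : ℝ) : EReal)

end TxModel

/-! The proof is a backward induction in which every cost function is affine on the cells between
consecutive multiples of `d`. Let `postValue` be the holding cost plus the discounted future cost as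
a function of the level after transmission, and `value` the cost before transmission. One dynamic
programming step minimizes, over z, the power for z packets plus `postValue` at x + z. Both terms
are convex, with slopes given by the increasing `slope k` and by the negatives of the decreasing
sequence `band`.

All endpoints of segments are multiples of `d`, so the comparisons that decide the minimizer are
constant while x stays in one cell. Either the minimizer is a fixed endpoint, and `value` inherits a
slope of `postValue`; or it fills the buffer up to a critical number, and `value` has slope minus
`slope k`. In both cases the marginal value is `pivot`, the median of the slopes and the relevant
entries of `band` (`action_on_interval`). Written out by cases (`pivot_eq_sum`), the recursion for
the medians is the recursion for `gamma`, up to the conventions for infinite and vanishing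
thresholds (`gammaEqBand`).

Optimality in one step is a tangent argument: at the prescribed action the power-rate curve and
`postValue` have tangents of opposite slope, whose sum is constant in z (`value_le`). For
history-dependent randomized policies, consider the cost of following a policy for t slots and the
base-stock rule afterwards. By the Bellman inequality it is nondecreasing in t, and it is constant
if the policy is itself base-stock; t = 0 gives `value` and t = N gives the cost of the policy. -/

/-! ### Medians of two monotone sequences -/

/-- The minimum of `a 0` and of `max (c l) (a (l + 1))` over `l < N`. -/
noncomputable def pivot (c a : ℕ → ℝ) : ℕ → ℝ
  | 0 => a 0
  | m + 1 => min (pivot c a m) (max (c m) (a (m + 1)))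

theorem pivot_le_zero (c a : ℕ → ℝ) (N : ℕ) : pivot c a N ≤ a 0 := by
  induction N with
  | zero => exact le_rfl
  | succ N ih => exact (min_le_left _ _).trans ih

theorem pivot_le (c a : ℕ → ℝ) {N l : ℕ} (hl : l < N) : pivot c a N ≤ max (c l) (a (l + 1)) := by
  induction N with
  | zero => omega
  | succ N ih =>
    rcases Nat.lt_succ_iff_lt_or_eq.1 hl with h | rfl
    · exact (min_le_left _ _).trans (ih h)
    · exact min_le_right _ _

theorem le_pivot {c a : ℕ → ℝ} {N : ℕ} {w : ℝ} (h0 : w ≤ a 0)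
    (h : ∀ l < N, w ≤ max (c l) (a (l + 1))) : w ≤ pivot c a N := by
  induction N with
  | zero => exact h0
  | succ N ih => exact le_min (ih fun l hl => h l (by omega)) (h N (by omega))

theorem pivot_mono {c a a' : ℕ → ℝ} {N : ℕ} (h : ∀ m ≤ N, a m ≤ a' m) :
    pivot c a N ≤ pivot c a' N :=
  le_pivot ((pivot_le_zero c a N).trans (h 0 (by omega))) fun l hl =>
    (pivot_le c a hl).trans (max_le_max le_rfl (h (l + 1) hl))

/-- For monotone sequences the pivot is the median of the 2N + 1 numbers c 0, …, c (N - 1), a 0, …,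
a N. Here c i with i < m and a j with j > m lie below a m, and the N remaining ones lie above. -/
theorem pivot_eq_threshold {c a : ℕ → ℝ} {N m : ℕ} (ha : ∀ i j, i ≤ j → j ≤ N → a j ≤ a i)
    (hc : ∀ i j, i ≤ j → j < N → c i ≤ c j) (hm : m ≤ N) (h1 : ∀ k, m = k + 1 → c k ≤ a m)
    (h2 : m < N → a m ≤ c m) : pivot c a N = a m := by
  apply le_antisymm
  · cases m with
    | zero => exact pivot_le_zero c a N
    | succ k => exact (pivot_le c a hm).trans (max_le (h1 k rfl) le_rfl)
  · refine le_pivot (ha 0 m (by omega) hm) fun l hl => ?_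
    rcases lt_or_ge l m with h | h
    · exact le_max_of_le_right (ha (l + 1) m h hm)
    · exact le_max_of_le_left ((h2 (by omega)).trans (hc m l h hl))

theorem pivot_eq_slope {c a : ℕ → ℝ} {N k : ℕ} (ha : ∀ i j, i ≤ j → j ≤ N → a j ≤ a i)
    (hc : ∀ i j, i ≤ j → j < N → c i ≤ c j) (hk : k < N) (h1 : a (k + 1) ≤ c k)
    (h2 : c k ≤ a k) : pivot c a N = c k := by
  apply le_antisymm
  · exact (pivot_le c a hk).trans (max_le le_rfl h1)
  · refine le_pivot (h2.trans (ha 0 k (by omega) (by omega))) fun l hl => ?_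
    rcases lt_or_ge l k with h | h
    · exact le_max_of_le_right (h2.trans (ha (l + 1) k h (by omega)))
    · exact le_max_of_le_left (hc k l h hl)

open Classical in
-- The conditions list the places where the increasing c can cross the decreasing a; exactly one of
-- them holds, so the sum is a case distinction. It has the shape of the recursion for `gamma`.
theorem pivot_eq_sum {c a : ℕ → ℝ} {K : ℕ} (ha : ∀ i j, i ≤ j → j ≤ K + 1 → a j ≤ a i)
    (hc : ∀ i j, i ≤ j → j < K + 1 → c i ≤ c j) :
    pivot c a (K + 1) = (if a 0 ≤ c 0 then a 0 else 0)
      + ∑ k ∈ Finset.range K, ((if a (k + 1) ≤ c k ∧ c k < a k then c k else 0)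
        + (if c k < a (k + 1) ∧ a (k + 1) ≤ c (k + 1) then a (k + 1) else 0))
      + (if a (K + 1) ≤ c K ∧ c K < a K then c K else 0)
      + (if c K < a (K + 1) then a (K + 1) else 0) := by
  -- The undecided case c m < a m is kept in the last summand and split at the next index; the other
  -- two clauses locate the partial pivot relative to c m.
  have key : ∀ m ≤ K, (pivot c a m = (if a 0 ≤ c 0 then a 0 else 0)
      + ∑ k ∈ Finset.range m, ((if a (k + 1) ≤ c k ∧ c k < a k then c k else 0)
        + (if c k < a (k + 1) ∧ a (k + 1) ≤ c (k + 1) then a (k + 1) else 0))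
      + (if c m < a m then a m else 0)) ∧ (c m < a m → pivot c a m = a m) ∧
      (a m ≤ c m → pivot c a m ≤ c m) := by
    intro m hm
    induction m with
    | zero =>
      simp only [pivot, Finset.range_zero, Finset.sum_empty]
      refine ⟨?_, by tauto, by tauto⟩
      split_ifs <;> linarith
    | succ m ih =>
      obtain ⟨h1, h2, h3⟩ := ih (by omega)
      have e1 := ha m (m + 1) (by omega) (by omega)
      have e2 := hc m (m + 1) (by omega) (by omega)
      rw [Finset.sum_range_succ]
      simp only [pivot]
      grind
  obtain ⟨h1, h2, h3⟩ := key K le_rfl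
  have e1 := ha K (K + 1) (by omega) (by omega)
  simp only [pivot]
  grind

/-! ### A closed formula for the base-stock action -/

/-- The maximum of `0` and of `min (τ (m + 1)) (b m - x)` over `m < N`. -/
noncomputable def orderUpTo (b τ : ℕ → ℝ) (x : ℝ) : ℕ → ℝ
  | 0 => 0
  | m + 1 => max (orderUpTo b τ x m) (min (τ (m + 1)) (b m - x))

theorem orderUpTo_nonneg (b τ : ℕ → ℝ) (x : ℝ) (N : ℕ) : 0 ≤ orderUpTo b τ x N := by
  induction N with
  | zero => exact le_rfl
  | succ N ih => exact le_max_of_le_left ih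

theorem le_orderUpTo (b τ : ℕ → ℝ) (x : ℝ) {N k : ℕ} (hk : k < N) :
    min (τ (k + 1)) (b k - x) ≤ orderUpTo b τ x N := by
  induction N with
  | zero => omega
  | succ N ih =>
    rcases Nat.lt_succ_iff_lt_or_eq.1 hk with h | rfl
    · exact le_max_of_le_left (ih h)
    · exact le_max_right _ _

theorem orderUpTo_le {b τ : ℕ → ℝ} {x w : ℝ} {N : ℕ} (h0 : 0 ≤ w)
    (h : ∀ k < N, min (τ (k + 1)) (b k - x) ≤ w) : orderUpTo b τ x N ≤ w := by
  induction N with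
  | zero => exact h0
  | succ N ih => exact max_le (ih fun k hk => h k (by omega)) (h N (by omega))

theorem continuous_orderUpTo (b τ : ℕ → ℝ) (N : ℕ) : Continuous fun x => orderUpTo b τ x N := by
  induction N with
  | zero => exact continuous_const
  | succ N ih => unfold orderUpTo; fun_prop

/-- Terms with index below m are bounded by τ m through their first entry, the others through their
second; the term with index m - 1 attains the bound. -/
theorem orderUpTo_eq_breakpoint {b τ : ℕ → ℝ} {x : ℝ} {N m : ℕ}
    (hb : ∀ i j, i ≤ j → j < N → b j ≤ b i) (hτ : ∀ i j, i ≤ j → j ≤ N → τ i ≤ τ j)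
    (h0 : τ 0 = 0) (hm : m ≤ N) (h1 : ∀ k, m = k + 1 → τ m ≤ b k - x)
    (h2 : m < N → b m - x ≤ τ m) : orderUpTo b τ x N = τ m := by
  apply le_antisymm
  · refine orderUpTo_le (h0 ▸ hτ 0 m (by omega) hm) fun l hl => ?_
    rcases lt_or_ge l m with h | h
    · exact min_le_of_left_le (hτ (l + 1) m h hm)
    · refine min_le_of_right_le ?_
      linarith [h2 (by omega), hb m l h hl]
  · cases m with
    | zero => rw [h0]; exact orderUpTo_nonneg _ _ _ _
    | succ k => exact (le_min le_rfl (h1 k rfl)).trans (le_orderUpTo b τ x hm)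

theorem orderUpTo_eq_sub {b τ : ℕ → ℝ} {x : ℝ} {N k : ℕ}
    (hb : ∀ i j, i ≤ j → j < N → b j ≤ b i) (hτ : ∀ i j, i ≤ j → j ≤ N → τ i ≤ τ j)
    (h0 : τ 0 = 0) (hk : k < N) (h1 : τ k ≤ b k - x) (h2 : b k - x ≤ τ (k + 1)) :
    orderUpTo b τ x N = b k - x := by
  apply le_antisymm
  · refine orderUpTo_le ((h0 ▸ hτ 0 k (by omega) (by omega)).trans h1) fun l hl => ?_
    rcases lt_or_ge l k with h | h
    · exact min_le_of_left_le ((hτ (l + 1) k h (by omega)).trans h1)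
    · refine min_le_of_right_le ?_
      linarith [hb k l h hl]
  · exact (le_min h2 le_rfl).trans (le_orderUpTo b τ x hk)

/-- Read p 0, q 0, p 1, q 1, …, p K, q K, True in this order and stop at the first true entry: its
predecessor, if any, is false. -/
theorem exists_alternation (K : ℕ) (p q : ℕ → Prop) :
    (∃ m ≤ K + 1, (∀ k, m = k + 1 → ¬ q k) ∧ (m < K + 1 → p m)) ∨ ∃ k < K + 1, ¬ p k ∧ q k := by
  by_contra! hcon
  obtain ⟨h1, h2⟩ := hcon
  have h : ∀ k < K + 1, ¬ p k := by
    intro k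
    induction k with
    | zero =>
      intro hk h
      exact (h1 0 (by omega) (by omega)).2 h
    | succ k ih =>
      intro hk h
      refine (h1 (k + 1) (by omega) ?_).2 h
      intro l hl
      obtain rfl : k = l := by omega
      exact h2 k (by omega) (ih (by omega))
  have := (h1 (K + 1) le_rfl fun k hk => by
    obtain rfl : K = k := by omega
    exact h2 K (by omega) (h K (by omega))).1
  omega

/-! ### Tangents of convex piecewise affine functions -/

/-- A function that is affine on consecutive intervals with nondecreasing slopes lies above each of
its tangents. -/
theorem tangent_le_of_slopes {f : ℝ → ℝ} {τ σ : ℕ → ℝ} {A B : ℕ}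
    (hτ : ∀ i, A ≤ i → i < B → τ i ≤ τ (i + 1)) (hσ : ∀ i j, A ≤ i → i ≤ j → j < B → σ i ≤ σ j)
    (hf : ∀ i, A ≤ i → i < B → ∀ x ∈ Set.Icc (τ i) (τ (i + 1)), ∀ y ∈ Set.Icc (τ i) (τ (i + 1)),
      f y - f x = σ i * (y - x))
    {m : ℕ} (hAm : A ≤ m) (hmB : m < B) {x y : ℝ} (hx : x ∈ Set.Icc (τ m) (τ (m + 1)))
    (hy : y ∈ Set.Icc (τ A) (τ B)) : f x + σ m * (y - x) ≤ f y := by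
  -- The tangent bound at the common endpoint of two cells is carried across the next cell, whose
  -- slope is at least σ m; `left` is the mirror image.
  have right : ∀ k, m + k < B → ∀ z ∈ Set.Icc (τ (m + k)) (τ (m + k + 1)),
      f x + σ m * (z - x) ≤ f z := by
    intro k
    induction k with
    | zero => intro hk z hz; linarith [hf m hAm hmB x hx z hz]
    | succ k ih =>
      intro hk z hz
      have e := hτ (m + k) (by omega) (by omega)
      have e' := hτ (m + (k + 1)) (by omega) (by omega)
      have h1 := ih (by omega) (τ (m + k + 1)) ⟨e, le_rfl⟩
      have h2 := hf (m + (k + 1)) (by omega) hk (τ (m + k + 1)) ⟨le_rfl, e'⟩ z hz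
      have h3 := mul_le_mul_of_nonneg_right (hσ m (m + (k + 1)) hAm (by omega) hk)
        (sub_nonneg.2 hz.1)
      rw [← add_assoc] at h3
      rw [← add_assoc] at h2
      linarith
  have left : ∀ k, A + k ≤ m → ∀ z ∈ Set.Icc (τ (m - k)) (τ (m - k + 1)),
      f x + σ m * (z - x) ≤ f z := by
    intro k
    induction k with
    | zero => intro hk z hz; linarith [hf m hAm hmB x hx z hz]
    | succ k ih =>
      intro hk z hz
      have e0 : m - (k + 1) + 1 = m - k := by omega
      rw [e0] at hz
      have e := hτ (m - k) (by omega) (by omega)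
      have e' := hτ (m - (k + 1)) (by omega) (by omega)
      rw [e0] at e'
      have h1 := ih (by omega) (τ (m - k)) ⟨le_rfl, e⟩
      have h2 := hf (m - (k + 1)) (by omega) (by omega) z (by rwa [e0]) (τ (m - k))
        (by rw [e0]; exact ⟨e', le_rfl⟩)
      have h3 := mul_le_mul_of_nonneg_right (hσ (m - (k + 1)) m (by omega) (by omega) hmB)
        (sub_nonneg.2 hz.2)
      linarith
  have cover : ∀ k, A + k ≤ B → ∀ z ∈ Set.Icc (τ A) (τ (A + k)),
      (z = τ A) ∨ ∃ i, A ≤ i ∧ i < B ∧ z ∈ Set.Icc (τ i) (τ (i + 1)) := by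
    intro k
    induction k with
    | zero => intro _ z hz; exact .inl (le_antisymm hz.2 hz.1)
    | succ k ih =>
      intro hk z hz
      rcases le_total z (τ (A + k)) with h | h
      · exact ih (by omega) z ⟨hz.1, h⟩
      · exact .inr ⟨A + k, by omega, by omega, h, hz.2⟩
  have : ∃ i, A ≤ i ∧ i < B ∧ y ∈ Set.Icc (τ i) (τ (i + 1)) := by
    rcases cover (B - A) (by omega) y (by rwa [show A + (B - A) = B by omega]) with h | h
    · exact ⟨A, le_rfl, by omega, h.ge, h.le.trans (hτ A le_rfl (by omega))⟩
    · exact h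
  obtain ⟨i, hAi, hiB, hi⟩ := this
  rcases le_total m i with h | h
  · obtain ⟨k, rfl⟩ := Nat.exists_eq_add_of_le h
    exact right k hiB y hi
  · refine left (m - i) (by omega) y ?_
    rwa [show m - (m - i) = i by omega]

/-! ### The grid, the marginal values and the thresholds -/

namespace TxModel

variable {S : Type*}

/-- The endpoints of the segments of the power-rate curve: `0`, the breakpoints, and `zMax`. -/
def endpt (M : TxModel S) (m : ℕ) (s : S) : ℝ := if m ≤ M.K then M.brkPrev m s else M.zMax s

/-- The endpoints of the segments of the power-rate curve, measured in multiples of `d`. -/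
noncomputable def endIdx (M : TxModel S) (m : ℕ) (s : S) : ℕ :=
  if m ≤ M.K then M.LPrev m s else M.LMax s

/-- The endpoints of the segments are multiples of `d`. -/
def OnGrid (M : TxModel S) : Prop := ∀ m s, m ≤ M.K + 1 → M.endpt m s = M.endIdx m s * M.d

variable (M : TxModel S)

theorem endpt_zero (s : S) : M.endpt 0 s = 0 := by simp [endpt, brkPrev]

theorem endpt_of_le {m : ℕ} (h : m ≤ M.K) (s : S) : M.endpt m s = M.brkPrev m s := if_pos h

theorem endpt_succ {k : ℕ} (h : k < M.K) (s : S) : M.endpt (k + 1) s = M.brk k s := if_pos h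

theorem endpt_last (s : S) : M.endpt (M.K + 1) s = M.zMax s := if_neg (by omega)

theorem endIdx_zero (s : S) : M.endIdx 0 s = 0 := by simp [endIdx, LPrev, brkPrev]

theorem endIdx_of_le {m : ℕ} (h : m ≤ M.K) (s : S) : M.endIdx m s = M.LPrev m s := if_pos h

theorem endIdx_succ {k : ℕ} (h : k < M.K) (s : S) : M.endIdx (k + 1) s = M.L k s := if_pos h

theorem endIdx_last (s : S) : M.endIdx (M.K + 1) s = M.LMax s := if_neg (by omega)

theorem zMax_pos (s : S) : 0 < M.zMax s := M.d_pos.trans_le (M.d_le_zMax s)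

theorem endpt_lt {m : ℕ} (h : m ≤ M.K) (s : S) : M.endpt m s < M.endpt (m + 1) s := by
  rcases h.lt_or_eq with h | rfl
  · rw [M.endpt_succ h, M.endpt_of_le h.le]
    cases m with
    | zero => exact M.brk_pos s 0 h
    | succ m => exact M.brk_lt s m h
  · rw [endpt_last, M.endpt_of_le le_rfl]
    rcases hK : M.K with _ | k
    · exact M.zMax_pos s
    · exact M.brk_lt_zMax s k (by omega)

theorem endpt_mono (s : S) (i j : ℕ) (hij : i ≤ j) (hj : j ≤ M.K + 1) :
    M.endpt i s ≤ M.endpt j s := by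
  induction j, hij using Nat.le_induction with
  | base => exact le_rfl
  | succ j hij ih => exact (ih (by omega)).trans (M.endpt_lt (by omega) s).le

theorem onGrid (hbrk : ∀ s, ∀ k < M.K, ∃ l : ℕ, 1 ≤ l ∧ M.brk k s = l * M.d)
    (hzMax : ∀ s, ∃ l : ℕ, 1 ≤ l ∧ M.zMax s = l * M.d) : M.OnGrid := by
  have hd := M.d_pos.ne'
  intro m s hm
  rcases hm.lt_or_eq with h | rfl
  · have hm : m ≤ M.K := by omega
    rw [M.endpt_of_le hm, M.endIdx_of_le hm]
    cases m with
    | zero => simp [LPrev, brkPrev]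
    | succ k =>
      obtain ⟨l, -, hl⟩ := hbrk s k hm
      simp [LPrev, brkPrev, hl, hd]
  · obtain ⟨l, -, hl⟩ := hzMax s
    simp [endpt_last, endIdx_last, LMax, hl, hd]

variable {M} in
theorem OnGrid.endIdx_lt (hM : M.OnGrid) {m : ℕ} (h : m ≤ M.K) (s : S) :
    M.endIdx m s < M.endIdx (m + 1) s := by
  have := M.endpt_lt h s
  rw [hM m s (by omega), hM (m + 1) s (by omega)] at this
  exact_mod_cast lt_of_mul_lt_mul_right this M.d_pos.le

variable {M} in
theorem OnGrid.endIdx_mono (hM : M.OnGrid) (s : S) (i j : ℕ) (hij : i ≤ j) (hj : j ≤ M.K + 1) :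
    M.endIdx i s ≤ M.endIdx j s := by
  have := M.endpt_mono s i j hij hj
  rw [hM i s (by omega), hM j s (by omega)] at this
  exact_mod_cast le_of_mul_le_mul_right this M.d_pos

theorem slope_le (s : S) (i j : ℕ) (hij : i ≤ j) (hj : j < M.K + 1) :
    M.slope i s ≤ M.slope j s := by
  induction j, hij using Nat.le_induction with
  | base => exact le_rfl
  | succ j hij ih => exact (ih (by omega)).trans (M.slope_mono s j (by omega))

theorem slope_pos' (s : S) {k : ℕ} (hk : k ≤ M.K) : 0 < M.slope k s :=
  (M.slope_pos s).trans_le (M.slope_le s 0 k (by omega) (by omega))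

variable [Fintype S]

/-- The sequence `g` with its entries of index at most `1` replaced by a number that is larger than
all slopes and than `g 2`. -/
noncomputable def capped (g : ℕ → ℝ) (j : ℕ) : ℝ :=
  if j ≤ 1 then 1 + ∑ s, M.slope M.K s + |g 2| else g j

/-- The marginal value, with `n + 1` slots remaining, of a packet that raises the buffer level after
transmission from `(j - 1) * d` to `j * d`, for `j ≥ 2`. -/
noncomputable def marginal : ℕ → ℕ → ℝ
  | 0, _ => -M.h
  | n + 1, j => -M.h + M.α * ∑ s, (M.p s).toReal *
      pivot (fun k => M.slope k s) (fun m => M.capped (marginal n) (j - 1 + M.endIdx m s)) (M.K + 1)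

/-- The real version of the thresholds with `n + 1` slots remaining: infinite thresholds are replaced
by large numbers, and thresholds of large index by nonpositive numbers. -/
noncomputable def band (n : ℕ) : ℕ → ℝ := M.capped (M.marginal n)

/-- The marginal value, with `n + 1` slots remaining and in channel condition `s`, of a packet that
raises the buffer level before transmission from `(i - 1) * d` to `i * d`. -/
noncomputable def stateMarginal (n i : ℕ) (s : S) : ℝ :=
  pivot (fun k => M.slope k s) (fun m => M.band n (i + M.endIdx m s)) (M.K + 1)

theorem marginal_succ (n j : ℕ) : M.marginal (n + 1) j =
    -M.h + M.α * ∑ s, (M.p s).toReal * M.stateMarginal n (j - 1) s := rfl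

theorem band_of_two_le (n : ℕ) {j : ℕ} (hj : 2 ≤ j) : M.band n j = M.marginal n j :=
  if_neg (by omega)

theorem slope_lt_band (n : ℕ) {j : ℕ} (hj : j ≤ 1) (s : S) {k : ℕ} (hk : k ≤ M.K) :
    M.slope k s < M.band n j := by
  rw [band, capped, if_pos hj]
  have h1 := M.slope_le s k M.K hk (by omega)
  have h2 := Finset.single_le_sum (f := fun s => M.slope M.K s)
    (fun s _ => (M.slope_pos' s le_rfl).le) (Finset.mem_univ s)
  have := abs_nonneg (M.marginal n 2)
  linarith

theorem capped_antitone {g : ℕ → ℝ} (hg : ∀ j, 2 ≤ j → g (j + 1) ≤ g j) : Antitone (M.capped g) := by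
  refine antitone_nat_of_succ_le fun j => ?_
  rw [capped, capped]
  have h0 : 0 ≤ ∑ s, M.slope M.K s := Finset.sum_nonneg fun s _ => (M.slope_pos' s le_rfl).le
  rcases lt_trichotomy j 1 with h | rfl | h
  · rw [if_pos h.le, if_pos (by omega)]
  · rw [if_neg (by omega), if_pos le_rfl]
    linarith [le_abs_self (g 2)]
  · rw [if_neg (by omega), if_neg (by omega)]
    exact hg j h

/-- This is the convexity of `postValue` in terms of slopes; it propagates because `pivot` is
monotone in its second sequence. -/
theorem band_antitone (n : ℕ) : Antitone (M.band n) := by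
  induction n with
  | zero => exact M.capped_antitone fun j _ => le_rfl
  | succ n ih =>
    refine M.capped_antitone fun j hj => ?_
    rw [marginal_succ, marginal_succ]
    refine add_le_add_right (mul_le_mul_of_nonneg_left (Finset.sum_le_sum fun s _ =>
      mul_le_mul_of_nonneg_left (pivot_mono fun m _ => ih ?_) ENNReal.toReal_nonneg) M.α_nonneg) _
    omega

variable {M} in
theorem OnGrid.band_anti (hM : M.OnGrid) (n i : ℕ) (s : S) (k l : ℕ) (hkl : k ≤ l)
    (hl : l ≤ M.K + 1) : M.band n (i + M.endIdx l s) ≤ M.band n (i + M.endIdx k s) :=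
  M.band_antitone n (by have := hM.endIdx_mono s k l hkl hl; omega)

/-- A packet that cannot be played out within the n + 1 remaining slots saves no power. Replacing
its marginal value by the threshold 0 therefore changes no comparison with a positive slope. -/
theorem marginal_nonpos (n : ℕ) : ∀ j, n + 1 < j → M.marginal n j ≤ 0 := by
  induction n with
  | zero => intro j _; simpa [marginal] using M.h_nonneg
  | succ n ih =>
    intro j hj
    rw [marginal_succ]
    have : ∑ s, (M.p s).toReal * M.stateMarginal n (j - 1) s ≤ 0 := by
      refine Finset.sum_nonpos fun s _ =>
        mul_nonpos_of_nonneg_of_nonpos ENNReal.toReal_nonneg ((pivot_le_zero _ _ _).trans ?_)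
      rw [endIdx_zero, M.band_of_two_le n (by omega)]
      exact ih _ (by omega)
    nlinarith [mul_nonneg M.α_nonneg (neg_nonneg.2 this), M.h_nonneg]

/-- The thresholds with `n + 1` slots remaining are given by `band n`, up to the conventions for the
thresholds that are infinite or vanish. -/
def GammaEqBand (n : ℕ) (γ : ℕ → EReal) : Prop :=
  γ 1 = ⊤ ∧ (∀ j, 2 ≤ j → j ≤ n + 1 → γ j = (M.band n j : EReal)) ∧ ∀ j, n + 1 < j → γ j = 0

variable {M}

theorem GammaEqBand.le_iff {n : ℕ} {γ : ℕ → EReal} (h : M.GammaEqBand n γ) {j : ℕ} (hj : 1 ≤ j)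
    (s : S) {k : ℕ} (hk : k ≤ M.K) : γ j ≤ (M.slope k s : EReal) ↔ M.band n j ≤ M.slope k s := by
  obtain ⟨h1, h2, h3⟩ := h
  rcases hj.eq_or_lt with rfl | hj
  · rw [h1]
    simpa using M.slope_lt_band n le_rfl s hk
  · rcases le_or_gt j (n + 1) with hjn | hjn
    · rw [h2 j hj hjn, EReal.coe_le_coe_iff]
    · have h := M.slope_pos' s hk
      rw [h3 j hjn, M.band_of_two_le n hj]
      exact iff_of_true (by exact_mod_cast h.le) ((M.marginal_nonpos n j hjn).trans h.le)

theorem GammaEqBand.lt_iff {n : ℕ} {γ : ℕ → EReal} (h : M.GammaEqBand n γ) {j : ℕ} (hj : 1 ≤ j)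
    (s : S) {k : ℕ} (hk : k ≤ M.K) : (M.slope k s : EReal) < γ j ↔ M.slope k s < M.band n j := by
  rw [← not_le, ← not_le, h.le_iff hj s hk]

theorem GammaEqBand.toReal_eq {n : ℕ} {γ : ℕ → EReal} (h : M.GammaEqBand n γ) {j : ℕ} (hj : 2 ≤ j)
    (hjn : j ≤ n + 1) : (γ j).toReal = M.band n j := by
  rw [h.2.1 j hj hjn, EReal.toReal_coe]

/-- An entry of `band` above a slope is positive, hence not one of those that the convention
replaces by 0. -/
theorem GammaEqBand.toReal_eq_of_lt {n : ℕ} {γ : ℕ → EReal} (h : M.GammaEqBand n γ) {j : ℕ}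
    (hj : 2 ≤ j) (s : S) {k : ℕ} (hk : k ≤ M.K) (hlt : M.slope k s < M.band n j) :
    (γ j).toReal = M.band n j := by
  refine h.toReal_eq hj (not_lt.1 fun hjn => ?_)
  rw [M.band_of_two_le n hj] at hlt
  linarith [M.marginal_nonpos n j hjn, M.slope_pos' s hk]

/-- For each channel condition the recursion for `gamma` is the expansion `pivot_eq_sum` of
`stateMarginal`; the conditions under the sums select only thresholds to which no convention
applies. -/
theorem OnGrid.gammaEqBand (hM : M.OnGrid) (n : ℕ) : M.GammaEqBand n (M.gamma (n + 1)) := by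
  induction n with
  | zero =>
    refine ⟨by simp [gamma], fun j h1 h2 => by omega, fun j hj => ?_⟩
    rw [gamma, if_neg (by omega), if_pos hj]
  | succ n ih =>
    refine ⟨by simp [gamma], fun j h1 h2 => ?_, fun j hj => ?_⟩
    swap
    · rw [gamma, if_neg (by omega), if_pos hj]
    rw [gamma, if_neg (by omega), if_neg (by omega), M.band_of_two_le _ h1, marginal_succ]
    congr 3
    obtain ⟨i, rfl⟩ : ∃ i, j = i + 1 := ⟨j - 1, by omega⟩
    rw [Nat.add_sub_cancel]
    simp only [Finset.sum_filter]
    have hsum : ∀ f g : ℕ → S → ℝ, ∑ k ∈ Finset.range M.K, (∑ s, f k s + ∑ s, g k s) =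
        ∑ s, ∑ k ∈ Finset.range M.K, (f k s + g k s) := by
      intro f g
      rw [Finset.sum_comm]
      exact Finset.sum_congr rfl fun k _ => Finset.sum_add_distrib.symm
    rw [hsum, ← Finset.sum_add_distrib, ← Finset.sum_add_distrib, ← Finset.sum_add_distrib]
    refine Finset.sum_congr rfl fun s _ => ?_
    rw [stateMarginal, pivot_eq_sum (fun k l => hM.band_anti n i s k l) (M.slope_le s), mul_add,
      mul_add, mul_add, Finset.mul_sum]
    congr 1
    · congr 1
      · congr 1
        · simp only [endIdx_zero, add_zero, ih.le_iff (j := i) (by omega) s (Nat.zero_le _),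
            mul_ite, mul_zero]
          refine if_ctx_congr Iff.rfl (fun h => ?_) fun _ => rfl
          -- The infinite threshold of index 1, whose `toReal` is a default value, is excluded by
          -- the condition.
          have : 2 ≤ i := by
            by_contra! hi
            exact absurd h (M.slope_lt_band n (by omega) s (Nat.zero_le _)).not_ge
          rw [ih.toReal_eq this (by omega)]
        · refine Finset.sum_congr rfl fun k hk => ?_
          have hk := Finset.mem_range.1 hk
          have hL := hM.endIdx_lt hk.le s
          rw [M.endIdx_of_le hk.le, M.endIdx_succ hk] at *
          have h1 : 1 ≤ i + M.L k s := by omega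
          have h2 : 1 ≤ i + M.LPrev k s := by omega
          simp only [ih.le_iff h1 s hk.le, ih.lt_iff h2 s hk.le, ih.lt_iff h1 s hk.le,
            ih.le_iff h1 s hk, mul_add, mul_ite, mul_zero]
          congr 1
          refine if_ctx_congr Iff.rfl (fun h => ?_) fun _ => rfl
          rw [ih.toReal_eq_of_lt (by omega) s hk.le h.1]
      · have h1 : 1 ≤ i + M.LMax s := by omega
        have h2 : 1 ≤ i + M.LPrev M.K s := by omega
        simp only [M.endIdx_of_le le_rfl, M.endIdx_last, ih.le_iff h1 s le_rfl,
          ih.lt_iff h2 s le_rfl, mul_ite, mul_zero]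
    · have hL := hM.endIdx_lt le_rfl s
      rw [M.endIdx_last] at *
      simp only [ih.lt_iff (show 1 ≤ i + M.LMax s by omega) s le_rfl, mul_ite, mul_zero]
      refine if_ctx_congr Iff.rfl (fun h => ?_) fun _ => rfl
      rw [ih.toReal_eq_of_lt (by omega) s le_rfl h]

theorem OnGrid.inBand_iff (hM : M.OnGrid) (n : ℕ) {k : ℕ} (hk : k ≤ M.K) (s : S) (j : ℕ) :
    M.InBand (n + 1) k s j ↔ 1 ≤ j ∧ M.band n (j + 1) ≤ M.slope k s ∧ M.slope k s < M.band n j := by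
  unfold InBand
  refine and_congr_right fun hj => ?_
  rw [(hM.gammaEqBand n).le_iff (by omega) s hk, (hM.gammaEqBand n).lt_iff hj s hk]

theorem OnGrid.inBand_le (hM : M.OnGrid) (n : ℕ) {k l : ℕ} (hkl : k ≤ l) (hl : l ≤ M.K) (s : S)
    {i j : ℕ} (hi : M.InBand (n + 1) k s i) (hj : M.InBand (n + 1) l s j) : j ≤ i := by
  rw [hM.inBand_iff n (hkl.trans hl)] at hi
  rw [hM.inBand_iff n hl] at hj
  by_contra! h
  have := M.band_antitone n (show i + 1 ≤ j from h)
  linarith [M.slope_le s k l hkl (by omega)]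

/-- The decreasing sequence `band n` starts above every slope at index 1 and is nonpositive from
index n + 2 on, so it crosses each slope exactly once. -/
theorem OnGrid.existsUnique_inBand (hM : M.OnGrid) (n : ℕ) {k : ℕ} (hk : k ≤ M.K) (s : S) :
    ∃! j, M.InBand (n + 1) k s j := by
  classical
  have hex : ∃ j, M.band n (j + 1) ≤ M.slope k s := by
    refine ⟨n + 1, ?_⟩
    rw [M.band_of_two_le n (by omega)]
    exact (M.marginal_nonpos n _ (by omega)).trans (M.slope_pos' s hk).le
  have h0 : Nat.find hex ≠ 0 := by
    rw [Ne, Nat.find_eq_zero, not_le]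
    exact M.slope_lt_band n le_rfl s hk
  obtain ⟨j, hj⟩ := Nat.exists_eq_succ_of_ne_zero h0
  have hband : M.InBand (n + 1) k s (j + 1) := by
    rw [hM.inBand_iff n hk]
    refine ⟨by omega, ?_, ?_⟩
    · have := Nat.find_spec hex
      rwa [hj] at this
    · exact not_le.1 (Nat.find_min hex (m := j) (by omega))
  exact ⟨j + 1, hband, fun i hi =>
    le_antisymm (hM.inBand_le n le_rfl hk s hband hi) (hM.inBand_le n le_rfl hk s hi hband)⟩

theorem OnGrid.crit_eq (hM : M.OnGrid) (n : ℕ) {k : ℕ} (hk : k ≤ M.K) (s : S) {j : ℕ}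
    (hj : M.InBand (n + 1) k s j) : M.crit (n + 1) k s = j * M.d := by
  have : {j : ℕ | M.InBand (n + 1) k s j} = {j} :=
    Set.eq_singleton_iff_unique_mem.2 ⟨hj, fun i hi => (hM.existsUnique_inBand n hk s).unique hi hj⟩
  rw [crit, this, csInf_singleton]

theorem OnGrid.crit_anti (hM : M.OnGrid) (n : ℕ) (s : S) (k l : ℕ) (hkl : k ≤ l)
    (hl : l < M.K + 1) : M.crit (n + 1) l s ≤ M.crit (n + 1) k s := by
  obtain ⟨i, hi, -⟩ := hM.existsUnique_inBand n (show k ≤ M.K by omega) s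
  obtain ⟨j, hj, -⟩ := hM.existsUnique_inBand n (show l ≤ M.K by omega) s
  rw [hM.crit_eq n (by omega) s hi, hM.crit_eq n (by omega) s hj]
  exact mul_le_mul_of_nonneg_right (by exact_mod_cast hM.inBand_le n hkl (by omega) s hi hj)
    M.d_pos.le

omit [Fintype S] in
theorem zMax_eq_of_linear (hK : M.K = 0) (s : S) : M.zMax s = M.P / M.slope 0 s := by
  have h := M.rate_zMax s
  rw [pwlRate, hK, Finset.range_zero, Finset.sum_empty, add_zero] at h
  rw [← h, mul_div_cancel_right₀ _ (M.slope_pos s).ne']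

theorem OnGrid.gamma_eq_gammaLin (hM : M.OnGrid) (hK : M.K = 0) (n : ℕ) :
    ∀ j, 1 ≤ j → M.gamma (n + 1) j = M.gammaLin (n + 1) j := by
  induction n with
  | zero =>
    intro j hj
    rw [gamma, gammaLin]
    split_ifs with h1 h2
    · rfl
    · rfl
    · omega
  | succ n ih =>
    intro j hj
    rw [gamma, gammaLin]
    split_ifs with h1 h2
    · rfl
    · rfl
    have hγ := hM.gammaEqBand n
    congr 3
    obtain ⟨i, rfl⟩ : ∃ i, j = i + 1 := ⟨j - 1, by omega⟩
    rw [Nat.add_sub_cancel]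
    have hfl : ∀ s, ⌊M.P / (M.d * M.slope 0 s)⌋₊ = M.LMax s := by
      intro s
      rw [LMax, zMax_eq_of_linear hK, div_div, mul_comm M.d]
    have h0 : ∀ s, M.LPrev 0 s = 0 := fun s => by simp [LPrev, brkPrev]
    have ih' : ∀ s, M.gammaLin (n + 1) (i + M.LMax s) = M.gamma (n + 1) (i + M.LMax s) :=
      fun s => (ih _ (by omega)).symm
    simp only [hfl, hK, h0, Finset.range_zero, Finset.sum_empty, add_zero, ih',
      ← ih i (by omega)]
    rw [add_assoc, add_assoc]
    congr 1
    simp only [Finset.sum_filter]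
    rw [← Finset.sum_add_distrib, ← Finset.sum_add_distrib]
    refine Finset.sum_congr rfl fun s _ => ?_
    -- Since c < γ at index i + L forces c < γ at index i, adding c on the larger event and γ - c on
    -- the smaller one equals the case distinction in `gamma`.
    have hanti : M.band n (i + M.LMax s) ≤ M.band n i := M.band_antitone n (by omega)
    have h1 : 1 ≤ i + M.LMax s := by omega
    have h2 : 1 ≤ i := by omega
    simp only [hγ.le_iff h1 s (Nat.zero_le _), hγ.lt_iff h2 s (Nat.zero_le _),
      hγ.lt_iff h1 s (Nat.zero_le _)]
    split_ifs <;> first | ring1 | grind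

end TxModel

/-! ### Convexity of the power-rate curve -/

namespace TxModel

variable {S : Type*}

section Rate

variable (M : TxModel S)

theorem sum_slope_sub (s : S) (k : ℕ) :
    M.slope 0 s + ∑ l ∈ Finset.range k, (M.slope (l + 1) s - M.slope l s) = M.slope k s := by
  rw [Finset.sum_range_sub (fun l => M.slope l s)]
  ring

theorem rate_sub_rate (s : S) (x y : ℝ) : M.rate y s - M.rate x s = M.slope 0 s * (y - x) +
    ∑ l ∈ Finset.range M.K, (M.slope (l + 1) s - M.slope l s) *
      (max (y - M.brk l s) 0 - max (x - M.brk l s) 0) := by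
  simp only [rate, pwlRate, mul_sub, Finset.sum_sub_distrib]
  ring

/-- On segment k exactly the kinks with index below k are active, and their slope increments
telescope. -/
theorem rate_affine (s : S) {k : ℕ} (hk : k < M.K + 1) {x y : ℝ}
    (hx : x ∈ Set.Icc (M.endpt k s) (M.endpt (k + 1) s))
    (hy : y ∈ Set.Icc (M.endpt k s) (M.endpt (k + 1) s)) :
    M.rate y s - M.rate x s = M.slope k s * (y - x) := by
  rw [rate_sub_rate, ← M.sum_slope_sub s k, add_mul, Finset.sum_mul]
  congr 1
  rw [← Finset.sum_subset (Finset.range_subset_range.2 (Nat.lt_succ_iff.1 hk))]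
  · refine Finset.sum_congr rfl fun l hl => ?_
    have hl := Finset.mem_range.1 hl
    have h := M.endpt_mono s (l + 1) k hl (by omega)
    rw [M.endpt_succ (by omega)] at h
    rw [max_eq_left (by linarith [hy.1]), max_eq_left (by linarith [hx.1])]
    ring
  · intro l hl hl'
    have hl := Finset.mem_range.1 hl
    rw [Finset.mem_range, not_lt] at hl'
    have h := M.endpt_mono s (k + 1) (l + 1) (by omega) (by omega)
    rw [M.endpt_succ hl] at h
    rw [max_eq_right (by linarith [hy.2]), max_eq_right (by linarith [hx.2])]
    ring

theorem rate_strictMono (s : S) : StrictMono fun z => M.rate z s := by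
  intro x y hxy
  rw [← sub_pos]
  simp only [rate_sub_rate]
  refine add_pos_of_pos_of_nonneg (mul_pos (M.slope_pos s) (sub_pos.2 hxy))
    (Finset.sum_nonneg fun l hl => mul_nonneg (sub_nonneg.2 (M.slope_mono s l ?_)) ?_)
  · exact Finset.mem_range.1 hl
  · exact sub_nonneg.2 (max_le_max (by linarith) le_rfl)

theorem rate_zero (s : S) : M.rate 0 s = 0 := by
  rw [rate, pwlRate, zero_mul, zero_add]
  refine Finset.sum_eq_zero fun l hl => ?_
  rw [max_eq_right (by linarith [M.brk_pos s l (Finset.mem_range.1 hl)]), mul_zero]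

theorem rate_nonneg (s : S) {z : ℝ} (hz : 0 ≤ z) : 0 ≤ M.rate z s := by
  have := (M.rate_strictMono s).monotone hz
  simpa only [rate_zero] using this

theorem rate_le_power_iff (s : S) (z : ℝ) : M.rate z s ≤ M.P ↔ z ≤ M.zMax s := by
  have h : M.rate (M.zMax s) s = M.P := M.rate_zMax s
  rw [← h]
  exact (M.rate_strictMono s).le_iff_le

theorem continuous_rate (s : S) : Continuous fun z => M.rate z s := by
  unfold rate pwlRate
  fun_prop

theorem rate_tangent (s : S) {k : ℕ} (hk : k < M.K + 1) {x y : ℝ}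
    (hx : x ∈ Set.Icc (M.endpt k s) (M.endpt (k + 1) s)) (hy : y ∈ Set.Icc 0 (M.zMax s)) :
    M.rate x s + M.slope k s * (y - x) ≤ M.rate y s := by
  refine tangent_le_of_slopes (f := fun z => M.rate z s) (τ := fun m => M.endpt m s)
    (σ := fun k => M.slope k s) (A := 0) (B := M.K + 1)
    (fun i _ hi => (M.endpt_lt (by omega) s).le) (fun i j _ hij hj => M.slope_le s i j hij hj)
    (fun i _ hi x hx y hy => M.rate_affine s hi hx hy) (Nat.zero_le _) hk hx ?_
  simpa only [endpt_zero, endpt_last] using hy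

/-- A number between the slopes to the left and to the right is a subgradient; at `0` and at `zMax`
one of the two sides is empty. -/
theorem rate_tangent_endpt (s : S) {m : ℕ} (hm : m ≤ M.K + 1) {c y : ℝ}
    (h1 : ∀ k, m = k + 1 → M.slope k s ≤ c) (h2 : m < M.K + 1 → c ≤ M.slope m s)
    (hy : y ∈ Set.Icc 0 (M.zMax s)) :
    M.rate (M.endpt m s) s + c * (y - M.endpt m s) ≤ M.rate y s := by
  rcases le_total y (M.endpt m s) with h | h
  · cases m with
    | zero =>
      obtain rfl : y = M.endpt 0 s := le_antisymm h (by rw [endpt_zero]; exact hy.1)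
      simp
    | succ k =>
      have := M.rate_tangent s hm (x := M.endpt (k + 1) s) ⟨(M.endpt_lt (by omega) s).le, le_rfl⟩ hy
      have := mul_le_mul_of_nonpos_right (h1 k rfl) (sub_nonpos.2 h)
      linarith
  · rcases hm.lt_or_eq with hm | rfl
    · have := M.rate_tangent s hm (x := M.endpt m s) ⟨le_rfl, (M.endpt_lt (by omega) s).le⟩ hy
      have := mul_le_mul_of_nonneg_right (h2 hm) (sub_nonneg.2 h)
      linarith
    · obtain rfl : y = M.endpt (M.K + 1) s := le_antisymm (by rw [endpt_last]; exact hy.2) h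
      simp

end Rate

/-! ### The base-stock action on grid cells -/

variable [Fintype S] (M : TxModel S)

/-- The number of packets that the finite generalized base-stock policy transmits in state `(x, s)`
with `n` slots remaining. -/
noncomputable def action (n : ℕ) (s : S) (x : ℝ) : ℝ :=
  orderUpTo (fun k => M.crit n k s) (fun m => M.endpt m s) x (M.K + 1)

theorem continuous_action (n : ℕ) (s : S) : Continuous (M.action n s) :=
  continuous_orderUpTo _ _ _

theorem action_nonneg (n : ℕ) (s : S) (x : ℝ) : 0 ≤ M.action n s x := orderUpTo_nonneg _ _ _ _

theorem action_le_zMax (n : ℕ) (s : S) (x : ℝ) : M.action n s x ≤ M.zMax s := by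
  refine orderUpTo_le (M.zMax_pos s).le fun k hk => min_le_of_left_le ?_
  rw [← endpt_last]
  exact M.endpt_mono s (k + 1) (M.K + 1) hk le_rfl

variable {M}

theorem OnGrid.action_eq_endpt (hM : M.OnGrid) (n : ℕ) (s : S) {x : ℝ} {m : ℕ} (hm : m ≤ M.K + 1)
    (h1 : ∀ k, m = k + 1 → x ≤ M.crit (n + 1) k s - M.endpt m s)
    (h2 : m < M.K + 1 → M.crit (n + 1) m s - M.endpt m s ≤ x) :
    M.action (n + 1) s x = M.endpt m s :=
  orderUpTo_eq_breakpoint (hM.crit_anti n s) (M.endpt_mono s) (M.endpt_zero s) hm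
    (fun k hk => by linarith [h1 k hk]) fun h => by linarith [h2 h]

theorem OnGrid.action_eq_sub (hM : M.OnGrid) (n : ℕ) (s : S) {x : ℝ} {k : ℕ} (hk : k < M.K + 1)
    (h1 : x ≤ M.crit (n + 1) k s - M.endpt k s)
    (h2 : M.crit (n + 1) k s - M.endpt (k + 1) s ≤ x) :
    M.action (n + 1) s x = M.crit (n + 1) k s - x :=
  orderUpTo_eq_sub (hM.crit_anti n s) (M.endpt_mono s) (M.endpt_zero s) hk (by linarith)
    (by linarith)

/-- Every clause agrees with one closed formula, which gives uniqueness without checking that the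
clauses are disjoint. -/
theorem OnGrid.eq_action (hM : M.OnGrid) {n : ℕ} {s : S} {x z : ℝ}
    (h : M.BaseStock (n + 1) x s z) : z = M.action (n + 1) s x := by
  rcases h with ⟨k, hk, h1, h2, rfl⟩ | ⟨k, hk, h1, h2, rfl⟩ | ⟨h1, h2, rfl⟩ | ⟨h1, h2, rfl⟩
  · rw [← M.endpt_of_le hk] at *
    refine (hM.action_eq_endpt n s (by omega) (fun l hl => ?_) fun _ => h1.le).symm
    subst hl
    exact h2 (by omega)
  · rw [← M.endpt_succ hk, ← M.endpt_of_le hk.le] at *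
    exact (hM.action_eq_sub n s (by omega) h2 h1.le).symm
  · rw [← M.endpt_last, ← M.endpt_of_le le_rfl] at *
    exact (hM.action_eq_sub n s (by omega) h2 h1.le).symm
  · rw [← M.endpt_last] at *
    refine (hM.action_eq_endpt n s le_rfl (fun l hl => ?_) fun h => by omega).symm
    obtain rfl : M.K = l := by omega
    exact h2

variable (M) in
theorem exists_baseStock (n : ℕ) (s : S) {x : ℝ} (hx : 0 ≤ x) : ∃ z, M.BaseStock n x s z := by
  rcases exists_alternation M.K (fun k => M.crit n k s - M.endpt k s < x)
    (fun k => M.crit n k s - M.endpt (k + 1) s < x) with ⟨m, hm, h1, h2⟩ | ⟨k, hk, h1, h2⟩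
  · rcases hm.lt_or_eq with hm | rfl
    · have hm' : m ≤ M.K := by omega
      rw [M.endpt_of_le hm'] at h2
      refine ⟨_, .inl ⟨m, hm', h2 hm, fun h => ?_, rfl⟩⟩
      obtain ⟨k, rfl⟩ := Nat.exists_eq_add_of_le' h
      have := not_lt.1 (h1 k rfl)
      rwa [M.endpt_of_le hm'] at this
    · have := not_lt.1 (h1 M.K rfl)
      rw [endpt_last] at this
      exact ⟨_, .inr (.inr (.inr ⟨hx, this, rfl⟩))⟩
  · rw [M.endpt_of_le (by omega), not_lt] at h1
    rcases (Nat.lt_succ_iff.1 hk).lt_or_eq with hk | rfl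
    · rw [M.endpt_succ hk] at h2
      exact ⟨_, .inr (.inl ⟨k, hk, h2, h1, rfl⟩)⟩
    · rw [endpt_last] at h2
      exact ⟨_, .inr (.inr (.inl ⟨h2, h1, rfl⟩))⟩

theorem OnGrid.baseStock_action (hM : M.OnGrid) (n : ℕ) (s : S) {x : ℝ} (hx : 0 ≤ x) :
    M.BaseStock (n + 1) x s (M.action (n + 1) s x) := by
  obtain ⟨z, hz⟩ := M.exists_baseStock (n + 1) s hx
  rwa [hM.eq_action hz] at hz

/-- The last term of the maximum suffices: critical numbers are at least `d` because band indices
start at 1, and `zMax` is at least `d`. -/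
theorem OnGrid.le_action (hM : M.OnGrid) (n : ℕ) (s : S) {x : ℝ} (hx : 0 ≤ x) :
    max 0 (M.d - x) ≤ M.action (n + 1) s x := by
  refine max_le (M.action_nonneg _ _ _) (le_trans (le_min ?_ ?_)
    (le_orderUpTo _ _ _ (Nat.lt_succ_self M.K)))
  · rw [endpt_last]
    linarith [M.d_le_zMax s]
  · obtain ⟨j, hj, -⟩ := hM.existsUnique_inBand n le_rfl s
    have h1 : (1 : ℝ) ≤ j := by exact_mod_cast hj.1
    rw [hM.crit_eq n le_rfl s hj]
    nlinarith [M.d_pos]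

/-- Comparisons of thresholds with slopes become comparisons of integers. The latter also locate a
whole cell relative to the critical numbers, so the median and the action are decided by the same
inequalities. -/
theorem OnGrid.band_le_slope_iff (hM : M.OnGrid) {n k : ℕ} (hk : k ≤ M.K) {s : S} {j : ℕ}
    (hj : M.InBand (n + 1) k s j) (t : ℕ) : M.band n (t + 1) ≤ M.slope k s ↔ j ≤ t := by
  rw [hM.inBand_iff n hk] at hj
  constructor
  · intro h
    by_contra! hlt
    linarith [M.band_antitone n (show t + 1 ≤ j from hlt)]
  · intro h
    linarith [M.band_antitone n (show j + 1 ≤ t + 1 by omega)]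

/-- On each interval between consecutive multiples of `d`, the base-stock policy either transmits a
fixed number of packets, an endpoint of a segment, or it transmits up to a fixed buffer level. -/
theorem OnGrid.action_on_interval (hM : M.OnGrid) (n i : ℕ) (s : S) :
    (∃ m ≤ M.K + 1, 1 ≤ i + M.endIdx m s ∧
      (∀ k, m = k + 1 → M.slope k s ≤ M.stateMarginal n (i + 1) s) ∧
      (m < M.K + 1 → M.stateMarginal n (i + 1) s ≤ M.slope m s) ∧
      M.stateMarginal n (i + 1) s = M.band n (i + M.endIdx m s + 1) ∧
      ∀ x ∈ Set.Icc (i * M.d) ((i + 1) * M.d), M.action (n + 1) s x = M.endpt m s) ∨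
    ∃ k < M.K + 1, M.stateMarginal n (i + 1) s = M.slope k s ∧
      ∀ x ∈ Set.Icc (i * M.d) ((i + 1) * M.d), M.action (n + 1) s x = M.crit (n + 1) k s - x ∧
        M.crit (n + 1) k s - x ∈ Set.Icc (M.endpt k s) (M.endpt (k + 1) s) := by
  have hd := M.d_pos
  have hidx : ∀ m, i + 1 + M.endIdx m s = i + M.endIdx m s + 1 := fun m => by omega
  have hanti := fun k l => hM.band_anti n (i + 1) s k l
  simp only [hidx] at hanti
  choose! J hJ using fun k (hk : k ≤ M.K) => (hM.existsUnique_inBand n hk s).exists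
  have hle := fun k (hk : k ≤ M.K) => hM.band_le_slope_iff hk (hJ k hk)
  have hcrit := fun k (hk : k ≤ M.K) => hM.crit_eq n hk s (hJ k hk)
  have hgrid := fun m => hM m s
  rcases exists_alternation M.K (fun k => J k ≤ i + M.endIdx k s)
    (fun k => J k ≤ i + M.endIdx (k + 1) s) with ⟨m, hm, h1, h2⟩ | ⟨k, hk, h1, h2⟩
  · have h1' : ∀ k, m = k + 1 → M.slope k s ≤ M.band n (i + M.endIdx m s + 1) := by
      rintro k rfl
      exact (not_le.1 fun h => h1 k rfl ((hle k (by omega) _).1 h)).le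
    have h2' : m < M.K + 1 → M.band n (i + M.endIdx m s + 1) ≤ M.slope m s := fun h =>
      (hle m (by omega) _).2 (h2 h)
    have hv : M.stateMarginal n (i + 1) s = M.band n (i + M.endIdx m s + 1) := by
      unfold stateMarginal
      simp only [hidx]
      exact pivot_eq_threshold (a := fun m => M.band n (i + M.endIdx m s + 1)) hanti (M.slope_le s)
        hm h1' h2'
    refine .inl ⟨m, hm, ?_, by rwa [hv], by rwa [hv], hv, fun x hx => ?_⟩
    -- For m = 0 this says that sending nothing is prescribed only from levels of at least `d`,
    -- which holds since J 0 ≥ 1.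
    · cases m with
      | zero => exact (hJ 0 (Nat.zero_le _)).1.trans (h2 (by omega))
      | succ k =>
        have := hM.endIdx_lt (show k ≤ M.K by omega) s
        omega
    · refine hM.action_eq_endpt n s hm ?_ fun h => ?_
      · rintro k rfl
        have h := not_le.1 (h1 k rfl)
        have : (i + M.endIdx (k + 1) s + 1 : ℝ) ≤ J k := by exact_mod_cast h
        rw [hcrit k (by omega), hgrid _ hm]
        nlinarith [hx.2]
      · have : (J m : ℝ) ≤ i + M.endIdx m s := by exact_mod_cast h2 h
        rw [hcrit m (by omega), hgrid _ hm]
        nlinarith [hx.1]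
  · have hv : M.stateMarginal n (i + 1) s = M.slope k s := by
      unfold stateMarginal
      simp only [hidx]
      exact pivot_eq_slope (a := fun m => M.band n (i + M.endIdx m s + 1)) hanti (M.slope_le s)
        hk ((hle k (by omega) _).2 h2) (not_le.1 fun h => h1 ((hle k (by omega) _).1 h)).le
    refine .inr ⟨k, hk, hv, fun x hx => ?_⟩
    have e1 : x ≤ M.crit (n + 1) k s - M.endpt k s := by
      have : (i + M.endIdx k s + 1 : ℝ) ≤ J k := by exact_mod_cast not_le.1 h1
      rw [hcrit k (by omega), hgrid _ hk.le]
      nlinarith [hx.2]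
    have e2 : M.crit (n + 1) k s - M.endpt (k + 1) s ≤ x := by
      have : (J k : ℝ) ≤ i + M.endIdx (k + 1) s := by exact_mod_cast h2
      rw [hcrit k (by omega), hgrid _ hk]
      nlinarith [hx.1]
    exact ⟨hM.action_eq_sub n s hk e1 e2, by linarith, by linarith⟩

theorem action_of_linear (hK : M.K = 0) (n : ℕ) (s : S) (x : ℝ) :
    M.action n s x = max 0 (min (M.zMax s) (M.crit n 0 s - x)) := by
  have := M.endpt_last s
  rw [hK] at this
  simp only [action, hK, orderUpTo, this]

/-! ### The value function and the Bellman inequality -/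

variable (M) in
/-- The expected cost of the base-stock policy over `n` slots from the state `(x, s)`. -/
noncomputable def value : ℕ → S → ℝ → ℝ
  | 0, _, _ => 0
  | n + 1, s, x => M.rate (M.action (n + 1) s x) s + (M.h * (x + M.action (n + 1) s x - M.d) +
      M.α * ∑ s', (M.p s').toReal * value n s' (x + M.action (n + 1) s x - M.d))

variable (M) in
/-- The holding cost of the current slot and the expected cost of the base-stock policy over the
next `n` slots, when the buffer level after transmission is `y`. -/
noncomputable def postValue (n : ℕ) (y : ℝ) : ℝ :=
  M.h * (y - M.d) + M.α * ∑ s, (M.p s).toReal * M.value n s (y - M.d)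

theorem value_succ (n : ℕ) (s : S) (x : ℝ) : M.value (n + 1) s x =
    M.rate (M.action (n + 1) s x) s + M.postValue n (x + M.action (n + 1) s x) := rfl

theorem continuous_value (n : ℕ) (s : S) : Continuous (M.value n s) := by
  induction n generalizing s with
  | zero => exact continuous_const
  | succ n ih =>
    have h1 := M.continuous_action (n + 1) s
    have h2 := (M.continuous_rate s).comp h1
    exact h2.add (by fun_prop)

theorem OnGrid.value_nonneg (hM : M.OnGrid) (n : ℕ) (s : S) {x : ℝ} (hx : 0 ≤ x) :
    0 ≤ M.value n s x := by
  induction n generalizing s x with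
  | zero => exact le_rfl
  | succ n ih =>
    have h := (le_max_right _ _).trans (hM.le_action n s hx)
    have h' : 0 ≤ x + M.action (n + 1) s x - M.d := by linarith
    have := M.h_nonneg
    have := M.α_nonneg
    have := M.rate_nonneg s (M.action_nonneg (n + 1) s x)
    have := Finset.sum_nonneg fun s' (_ : s' ∈ Finset.univ) =>
      mul_nonneg (ENNReal.toReal_nonneg (a := M.p s')) (ih s' h')
    unfold value
    positivity

/-- `postValue n` is affine between consecutive multiples of `d`. -/
def PostAffine (M : TxModel S) (n : ℕ) : Prop :=
  ∀ i : ℕ, 1 ≤ i → ∀ x ∈ Set.Icc (i * M.d) ((i + 1) * M.d),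
    ∀ y ∈ Set.Icc (i * M.d) ((i + 1) * M.d),
      M.postValue n y - M.postValue n x = -M.band n (i + 1) * (y - x)

/-- If a fixed endpoint is transmitted, the cell is shifted by a multiple of `d` onto a cell of
`postValue`. If the buffer is filled to a fixed level, only the power varies, with one packet less
for each packet in the buffer. -/
theorem OnGrid.value_affine (hM : M.OnGrid) {n : ℕ} (hn : M.PostAffine n) (s : S) (i : ℕ)
    {x y : ℝ} (hx : x ∈ Set.Icc (i * M.d) ((i + 1) * M.d))
    (hy : y ∈ Set.Icc (i * M.d) ((i + 1) * M.d)) :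
    M.value (n + 1) s y - M.value (n + 1) s x = -M.stateMarginal n (i + 1) s * (y - x) := by
  rw [value_succ, value_succ]
  rcases hM.action_on_interval n i s with ⟨m, hm, hi, -, -, hv, h⟩ | ⟨k, hk, hv, h⟩
  · rw [h x hx, h y hy, hv, hM m s hm]
    have shift : ∀ w ∈ Set.Icc (i * M.d) ((i + 1) * M.d), w + M.endIdx m s * M.d ∈
        Set.Icc ((i + M.endIdx m s : ℕ) * M.d) (((i + M.endIdx m s : ℕ) + 1) * M.d) := by
      intro w hw
      push_cast
      constructor <;> linarith [hw.1, hw.2]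
    have := hn _ hi _ (shift x hx) _ (shift y hy)
    linarith
  · obtain ⟨ex, hx'⟩ := h x hx
    obtain ⟨ey, hy'⟩ := h y hy
    rw [ex, ey, hv, add_sub_cancel, add_sub_cancel]
    linarith [M.rate_affine s hk hx' hy']

/-- Playing out `d` packets moves cell i to cell i - 1 of `value`; this is why only cells with i ≥ 1
occur. -/
theorem OnGrid.postAffine (hM : M.OnGrid) (n : ℕ) : M.PostAffine n := by
  induction n with
  | zero =>
    intro i hi x _ y _
    rw [M.band_of_two_le 0 (by omega)]
    simp only [postValue, value, marginal, mul_zero, Finset.sum_const_zero]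
    ring
  | succ n ih =>
    intro i hi x hx y hy
    obtain ⟨i, rfl⟩ := Nat.exists_eq_add_of_le' hi
    have shift : ∀ w ∈ Set.Icc ((i + 1 : ℕ) * M.d) (((i + 1 : ℕ) + 1) * M.d), w - M.d ∈
        Set.Icc (i * M.d) ((i + 1) * M.d) := by
      intro w hw
      push_cast at hw
      constructor <;> linarith [hw.1, hw.2]
    have h := fun s => hM.value_affine ih s i (shift x hx) (shift y hy)
    rw [M.band_of_two_le _ (by omega), marginal_succ, Nat.add_sub_cancel]
    have hsum : ∑ s, (M.p s).toReal * M.value (n + 1) s (y - M.d) -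
        ∑ s, (M.p s).toReal * M.value (n + 1) s (x - M.d) =
        -(∑ s, (M.p s).toReal * M.stateMarginal n (i + 1) s) * (y - x) := by
      rw [← Finset.sum_sub_distrib, ← Finset.sum_neg_distrib, Finset.sum_mul]
      refine Finset.sum_congr rfl fun s _ => ?_
      rw [← mul_sub, h s]
      ring
    unfold postValue
    linear_combination M.α * hsum

theorem OnGrid.postValue_tangent (hM : M.OnGrid) (n : ℕ) {t : ℕ} (ht : 1 ≤ t) {x y : ℝ}
    (hx : x ∈ Set.Icc (t * M.d) ((t + 1) * M.d)) (hy : M.d ≤ y) :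
    M.postValue n x - M.band n (t + 1) * (y - x) ≤ M.postValue n y := by
  have hd := M.d_pos
  -- The tangent lemma needs finitely many cells, enough to contain both y and cell t.
  obtain ⟨B, hB⟩ := exists_nat_gt (y / M.d)
  rw [div_lt_iff₀ hd] at hB
  have := tangent_le_of_slopes (f := M.postValue n) (τ := fun i => i * M.d)
    (σ := fun i => -M.band n (i + 1)) (A := 1) (B := max B (t + 1)) (m := t) (x := x) (y := y)
    (fun i _ _ => by push_cast; linarith)
    (fun i j _ hij _ => neg_le_neg (M.band_antitone n (by omega)))
    (fun i hi _ x hx y hy => hM.postAffine n i hi x (by exact_mod_cast hx) y (by exact_mod_cast hy))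
    ht (by omega) (by exact_mod_cast hx) ⟨by simpa using hy, ?_⟩
  · linarith
  · have : (B : ℝ) ≤ (max B (t + 1) : ℕ) := by exact_mod_cast le_max_left _ _
    nlinarith

/-- The defining band of the critical number says that minus `slope k` lies between the slopes of
`postValue` to its left and right. If j = 1, no admissible level lies to the left. -/
theorem OnGrid.postValue_tangent_crit (hM : M.OnGrid) (n : ℕ) {k : ℕ} (hk : k ≤ M.K) (s : S)
    {y : ℝ} (hy : M.d ≤ y) :
    M.postValue n (M.crit (n + 1) k s) - M.slope k s * (y - M.crit (n + 1) k s) ≤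
      M.postValue n y := by
  have hd := M.d_pos
  obtain ⟨j, hj, -⟩ := hM.existsUnique_inBand n hk s
  rw [hM.crit_eq n hk s hj]
  rw [hM.inBand_iff n hk] at hj
  obtain ⟨hj1, hj2, hj3⟩ := hj
  rcases le_total (j * M.d) y with h | h
  · have := hM.postValue_tangent n hj1 (x := j * M.d) ⟨le_rfl, by linarith⟩ hy
    have := mul_le_mul_of_nonneg_right hj2 (sub_nonneg.2 h)
    linarith
  · rcases hj1.eq_or_lt with rfl | hj1
    · obtain rfl : y = (1 : ℕ) * M.d := le_antisymm h (by simpa using hy)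
      simp
    · obtain ⟨j, rfl⟩ := Nat.exists_eq_add_of_le' hj1.le
      have := hM.postValue_tangent n (t := j) (by omega) (x := (j + 1 : ℕ) * M.d)
        ⟨by push_cast; linarith, by push_cast; linarith⟩ hy
      have := mul_le_mul_of_nonpos_right hj3.le (sub_nonpos.2 h)
      linarith

/-- The Bellman inequality. -/
theorem OnGrid.value_le (hM : M.OnGrid) (n : ℕ) (s : S) {x z : ℝ} (hx : 0 ≤ x)
    (hz : z ∈ Set.Icc 0 (M.zMax s)) (hxz : M.d ≤ x + z) :
    M.value (n + 1) s x ≤ M.rate z s + M.postValue n (x + z) := by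
  have hd := M.d_pos
  set i := ⌊x / M.d⌋₊ with hi
  have hxi : x ∈ Set.Icc (i * M.d) ((i + 1) * M.d) := by
    constructor
    · exact (le_div_iff₀ hd).1 (Nat.floor_le (by positivity))
    · exact (div_le_iff₀ hd).1 (Nat.lt_floor_add_one _).le
  rw [value_succ]
  rcases hM.action_on_interval n i s with ⟨m, hm, hi, h1, h2, hv, h⟩ | ⟨k, hk, hv, h⟩
  · rw [h x hxi]
    -- The two tangents have slopes plus and minus `stateMarginal`, so their linear terms cancel in
    -- the sum; in the other case the slopes are plus and minus `slope k`.
    have e1 := M.rate_tangent_endpt s hm h1 h2 hz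
    have e2 := hM.postValue_tangent n hi (x := x + M.endpt m s) (y := x + z)
      (by rw [hM m s hm]; push_cast; constructor <;> linarith [hxi.1, hxi.2]) hxz
    rw [← hv] at e2
    linarith
  · obtain ⟨e, he⟩ := h x hxi
    rw [e, add_sub_cancel]
    have e1 := M.rate_tangent s hk he hz
    have e2 := hM.postValue_tangent_crit n (show k ≤ M.K by omega) s hxz
    linarith

end TxModel

/-! ### One-slot disintegration of the law -/

namespace TxModel

section Law

variable {S : Type*} [MeasurableSpace S] (M : TxModel S)

theorem measurable_snoc (t : ℕ) : Measurable fun q : ((Fin t → TxSlot S) × (ℝ × S)) × ℝ =>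
    Fin.snoc (α := fun _ => TxSlot S) q.1.1 (q.1.2, q.2) := by
  refine measurable_pi_iff.2 fun i => ?_
  refine Fin.lastCases ?_ (fun i => ?_) i
  · simp only [Fin.snoc_last]; fun_prop
  · simp only [Fin.snoc_castSucc]; fun_prop

theorem lintegral_law_succ (π : TxPolicy S) (x : ℝ) (s : S) (t : ℕ)
    {F : (Fin (t + 1) → TxSlot S) → ℝ≥0∞} (hF : Measurable F) :
    ∫⁻ ω, F ω ∂(M.law π x s (t + 1)) = ∫⁻ ω, ∫⁻ y, ∫⁻ z,
      F (Fin.snoc (α := fun _ => TxSlot S) ω (y, z)) ∂(π.act t (ω, y)) ∂(M.stateKernel x s t ω)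
        ∂(M.law π x s t) := by
  have := π.markov t
  have h : Measurable fun q : ((Fin t → TxSlot S) × (ℝ × S)) × ℝ =>
    F (Fin.snoc (α := fun _ => TxSlot S) q.1.1 (q.1.2, q.2)) := hF.comp (measurable_snoc t)
  rw [law, lintegral_map hF (measurable_snoc t), Measure.lintegral_compProd h,
    Measure.lintegral_compProd h.lintegral_kernel_prod_right']

theorem ae_law_succ_iff (π : TxPolicy S) (x : ℝ) (s : S) (t : ℕ)
    {Q : (Fin (t + 1) → TxSlot S) → Prop} (hQ : MeasurableSet {ω | Q ω}) :
    (∀ᵐ ω ∂(M.law π x s (t + 1)), Q ω) ↔ ∀ᵐ ω ∂(M.law π x s t), ∀ᵐ y ∂(M.stateKernel x s t ω),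
      ∀ᵐ z ∂(π.act t (ω, y)), Q (Fin.snoc (α := fun _ => TxSlot S) ω (y, z)) := by
  have := π.markov t
  have h : MeasurableSet {q : ((Fin t → TxSlot S) × (ℝ × S)) × ℝ |
    Q (Fin.snoc (α := fun _ => TxSlot S) q.1.1 (q.1.2, q.2))} := measurable_snoc t hQ
  have hact : MeasurableSet {q : (Fin t → TxSlot S) × (ℝ × S) |
      ∀ᵐ z ∂(π.act t q), Q (Fin.snoc (α := fun _ => TxSlot S) q.1 (q.2, z))} :=
    Kernel.measurable_kernel_prodMk_left h.compl (measurableSet_singleton 0)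
  rw [law, ae_map_iff (measurable_snoc t).aemeasurable hQ, Measure.ae_compProd_iff h,
    Measure.ae_compProd_iff hact]

/-- A property of the records of all slots holds almost surely in the first `t + 1` slots if and only
if it does so in the first `t` slots and in slot `t`. -/
theorem ae_law_forall_succ_iff (π : TxPolicy S) (x : ℝ) (s : S) (t : ℕ) {Q : ℕ → TxSlot S → Prop}
    (hQ : ∀ i, MeasurableSet {r | Q i r}) :
    (∀ᵐ ω ∂(M.law π x s (t + 1)), ∀ i : Fin (t + 1), Q i (ω i)) ↔
      (∀ᵐ ω ∂(M.law π x s t), ∀ i : Fin t, Q i (ω i)) ∧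
      ∀ᵐ ω ∂(M.law π x s t), ∀ᵐ y ∂(M.stateKernel x s t ω), ∀ᵐ z ∂(π.act t (ω, y)), Q t (y, z) := by
  have := π.markov t
  rw [ae_law_succ_iff, ← Filter.eventually_and]
  -- The condition on the past does not involve y and z, and the kernels are Markov, so its inner
  -- quantifiers drop out.
  · simp only [Fin.forall_fin_succ', Fin.snoc_castSucc, Fin.snoc_last, Fin.val_castSucc,
      Fin.val_last, Filter.eventually_and, Filter.eventually_const]
  · simp only [Set.ofPred_forall]
    exact MeasurableSet.iInter fun i => measurable_pi_apply i (hQ i)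

variable [Fintype S] [DiscreteMeasurableSpace S]

theorem measurable_of_slices {f : ℝ × S → ℝ} (hf : ∀ s, Measurable fun x => f (x, s)) :
    Measurable f :=
  measurable_from_prod_countable_left hf

theorem ae_stateKernel_zero (x : ℝ) (s : S) (ω : Fin 0 → TxSlot S) :
    ∀ᵐ y ∂(M.stateKernel x s 0 ω), y = (x, s) := by
  rw [stateKernel, Kernel.const_apply, ae_dirac_eq]
  exact rfl

omit [DiscreteMeasurableSpace S] in
theorem stateKernel_succ_apply (x : ℝ) (s : S) (t : ℕ) (ω : Fin (t + 1) → TxSlot S) :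
    M.stateKernel x s (t + 1) ω = M.p.toMeasure.map
      (Prod.mk ((ω (Fin.last t)).1.1 + (ω (Fin.last t)).2 - M.d)) := by
  rw [stateKernel, Kernel.prod_apply, Kernel.deterministic_apply, Kernel.const_apply,
    Measure.dirac_prod]

omit [DiscreteMeasurableSpace S] in
theorem ae_stateKernel_succ (x : ℝ) (s : S) (t : ℕ) (ω : Fin (t + 1) → TxSlot S) :
    ∀ᵐ y ∂(M.stateKernel x s (t + 1) ω),
      y.1 = (ω (Fin.last t)).1.1 + (ω (Fin.last t)).2 - M.d := by
  rw [stateKernel_succ_apply, ae_map_iff measurable_prodMk_left.aemeasurable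
    (measurableSet_eq_fun measurable_fst measurable_const)]
  exact Filter.Eventually.of_forall fun _ => rfl

theorem lintegral_stateKernel_succ (x : ℝ) (s : S) (t : ℕ) (ω : Fin (t + 1) → TxSlot S)
    {f : ℝ × S → ℝ≥0∞} (hf : Measurable f) :
    ∫⁻ y, f y ∂(M.stateKernel x s (t + 1) ω) =
      ∑ s', M.p s' * f ((ω (Fin.last t)).1.1 + (ω (Fin.last t)).2 - M.d, s') := by
  rw [stateKernel_succ_apply, lintegral_map hf measurable_prodMk_left, lintegral_fintype]
  refine Finset.sum_congr rfl fun s' _ => ?_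
  rw [PMF.toMeasure_apply_singleton _ _ (measurableSet_singleton s'), mul_comm]

theorem measurable_rate : Measurable fun r : TxSlot S => M.rate r.2 r.1.2 := by
  have h : Measurable fun q : ℝ × S => M.rate q.1 q.2 :=
    measurable_of_slices fun s => (M.continuous_rate s).measurable
  exact h.comp (by fun_prop : Measurable fun r : TxSlot S => (r.2, r.1.2))

theorem measurable_value (n : ℕ) : Measurable fun y : ℝ × S => M.value n y.2 y.1 :=
  measurable_of_slices fun s => (continuous_value n s).measurable

theorem measurable_action (n : ℕ) : Measurable fun y : ℝ × S => M.action n y.2 y.1 :=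
  measurable_of_slices fun s => (M.continuous_action n s).measurable

end Law

/-! ### Feasible policies and finiteness of their cost -/

variable {S : Type*} (M : TxModel S)

/-- The underflow, nonnegativity and power constraints for the record of one slot. -/
def Admissible (r : TxSlot S) : Prop := max 0 (M.d - r.1.1) ≤ r.2 ∧ M.rate r.2 r.1.2 ≤ M.P

/-- The power and holding cost of one slot. -/
noncomputable def slotCost (r : TxSlot S) : ℝ := M.rate r.2 r.1.2 + M.h * (r.1.1 + r.2 - M.d)

/-- The discounted cost of the first `t` slots. -/
noncomputable def pastCost (t : ℕ) (ω : Fin t → TxSlot S) : ℝ≥0∞ :=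
  ∑ i : Fin t, ENNReal.ofReal (M.α ^ (i : ℕ) * M.slotCost (ω i))

variable {M}

theorem Admissible.le_zMax {r : TxSlot S} (h : M.Admissible r) : r.2 ≤ M.zMax r.1.2 :=
  (M.rate_le_power_iff _ _).1 h.2

theorem Admissible.nonneg {r : TxSlot S} (h : M.Admissible r) : 0 ≤ r.2 :=
  (le_max_left _ _).trans h.1

theorem Admissible.next_nonneg {r : TxSlot S} (h : M.Admissible r) : 0 ≤ r.1.1 + r.2 - M.d := by
  linarith [(le_max_right _ _).trans h.1]

theorem Admissible.slotCost_nonneg {r : TxSlot S} (h : M.Admissible r) : 0 ≤ M.slotCost r :=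
  add_nonneg (M.rate_nonneg _ h.nonneg) (mul_nonneg M.h_nonneg h.next_nonneg)

theorem pastCost_snoc (t : ℕ) (ω : Fin t → TxSlot S) (r : TxSlot S) :
    M.pastCost (t + 1) (Fin.snoc (α := fun _ => TxSlot S) ω r) =
      M.pastCost t ω + ENNReal.ofReal (M.α ^ t * M.slotCost r) := by
  simp [pastCost, Fin.sum_univ_castSucc]

variable [Fintype S]

theorem OnGrid.admissible_action (hM : M.OnGrid) (n : ℕ) {x : ℝ} (hx : 0 ≤ x) (s : S) :
    M.Admissible ((x, s), M.action (n + 1) s x) :=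
  ⟨hM.le_action n s hx, (M.rate_le_power_iff _ _).2 (M.action_le_zMax _ _ _)⟩

variable [MeasurableSpace S] [DiscreteMeasurableSpace S]

variable (M) in
theorem measurableSet_admissible : MeasurableSet {r : TxSlot S | M.Admissible r} := by
  have h : MeasurableSet {r : TxSlot S | max 0 (M.d - r.1.1) ≤ r.2} :=
    measurableSet_le (by fun_prop) (by fun_prop)
  exact h.inter (measurableSet_le M.measurable_rate measurable_const)

variable (M) in
theorem measurable_slotCost : Measurable fun r : TxSlot S => M.slotCost r :=
  M.measurable_rate.add (by fun_prop)

variable (M) in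
theorem measurable_pastCost (t : ℕ) : Measurable (M.pastCost t) :=
  Finset.measurable_sum _ fun i _ =>
    ((M.measurable_slotCost.comp (measurable_pi_apply i)).const_mul _).ennreal_ofReal

theorem feasible_succ_iff (t : ℕ) (π : TxPolicy S) (x : ℝ) (s : S) :
    M.Feasible (t + 1) π x s ↔ M.Feasible t π x s ∧
      ∀ᵐ ω ∂(M.law π x s t), ∀ᵐ y ∂(M.stateKernel x s t ω), ∀ᵐ z ∂(π.act t (ω, y)),
        M.Admissible (y, z) :=
  M.ae_law_forall_succ_iff π x s t (Q := fun _ r => M.Admissible r)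
    fun _ => M.measurableSet_admissible

theorem Feasible.mono {t u : ℕ} (htu : t ≤ u) {π : TxPolicy S} {x : ℝ} {s : S}
    (h : M.Feasible u π x s) : M.Feasible t π x s := by
  induction u, htu using Nat.le_induction with
  | base => exact h
  | succ u _ ih => exact ih ((feasible_succ_iff u π x s).1 h).1

theorem Feasible.buffer_nonneg {t : ℕ} {π : TxPolicy S} {x : ℝ} {s : S} (hx : 0 ≤ x)
    (h : M.Feasible t π x s) :
    ∀ᵐ ω ∂(M.law π x s t), ∀ᵐ y ∂(M.stateKernel x s t ω), 0 ≤ y.1 := by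
  cases t with
  | zero =>
    refine Filter.Eventually.of_forall fun ω => ?_
    filter_upwards [M.ae_stateKernel_zero x s ω] with y hy
    rwa [hy]
  | succ t =>
    filter_upwards [h] with ω hω
    filter_upwards [M.ae_stateKernel_succ x s t ω] with y hy
    rw [hy]
    exact Admissible.next_nonneg (M := M) (hω (Fin.last t))

theorem Feasible.buffer_le {t : ℕ} {π : TxPolicy S} {x : ℝ} {s : S} (h : M.Feasible t π x s) :
    ∀ᵐ ω ∂(M.law π x s t), ∀ i : Fin t, (ω i).1.1 ≤ x + (i : ℕ) * ∑ s, M.zMax s := by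
  have hZ : ∀ s, M.zMax s ≤ ∑ s, M.zMax s := fun s =>
    Finset.single_le_sum (f := M.zMax) (fun s _ => (M.zMax_pos s).le) (Finset.mem_univ s)
  induction t with
  | zero => exact Filter.Eventually.of_forall fun ω i => i.elim0
  | succ t ih =>
    have h' := ((feasible_succ_iff t π x s).1 h).1
    refine (M.ae_law_forall_succ_iff π x s t
      (Q := fun i r => r.1.1 ≤ x + (i : ℕ) * ∑ s, M.zMax s)
      fun i => measurableSet_le (by fun_prop) measurable_const).2 ⟨ih h', ?_⟩
    cases t with
    | zero =>
      refine Filter.Eventually.of_forall fun ω => ?_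
      filter_upwards [M.ae_stateKernel_zero x s ω] with y hy
      exact Filter.Eventually.of_forall fun z => by simp [hy]
    | succ t =>
      filter_upwards [h', ih h'] with ω hω hω'
      filter_upwards [M.ae_stateKernel_succ x s t ω] with y hy
      refine Filter.Eventually.of_forall fun z => ?_
      have h1 := Admissible.le_zMax (M := M) (hω (Fin.last t))
      have h2 := hω' (Fin.last t)
      have h3 := hZ (ω (Fin.last t)).1.2
      have h4 := M.d_pos
      rw [Fin.val_last] at h2
      simp only [hy]
      push_cast
      linarith

/-- Buffer levels grow by at most the sum of all `zMax` per slot, so feasible costs are bounded.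
This matters because `toReal` would send an infinite cost of a competitor to 0. -/
theorem Feasible.lintegral_pastCost_ne_top {N : ℕ} {π : TxPolicy S} {x : ℝ} {s : S}
    (h : M.Feasible N π x s) : ∫⁻ ω, M.pastCost N ω ∂(M.law π x s N) ≠ ∞ := by
  set B : ℝ≥0∞ := ∑ i : Fin N, ENNReal.ofReal
    (M.α ^ (i : ℕ) * (M.P + M.h * (x + (i : ℕ) * ∑ s, M.zMax s + ∑ s, M.zMax s))) with hB
  have hB' : B ≠ ∞ := ENNReal.sum_ne_top.2 fun i _ => ENNReal.ofReal_ne_top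
  have hle : ∫⁻ ω, M.pastCost N ω ∂(M.law π x s N) ≤ ∫⁻ _, B ∂(M.law π x s N) := by
    refine lintegral_mono_ae ?_
    filter_upwards [h, h.buffer_le] with ω h1 h2
    refine Finset.sum_le_sum fun i _ => ENNReal.ofReal_le_ofReal
      (mul_le_mul_of_nonneg_left (add_le_add (h1 i).2 (mul_le_mul_of_nonneg_left ?_ M.h_nonneg))
        (pow_nonneg M.α_nonneg _))
    have e1 := Admissible.le_zMax (M := M) (h1 i)
    have e2 := Finset.single_le_sum (f := M.zMax) (fun s _ => (M.zMax_pos s).le)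
      (Finset.mem_univ (ω i).1.2)
    linarith [h2 i, M.d_pos]
  rw [lintegral_const, measure_univ, mul_one] at hle
  exact ne_top_of_le_ne_top hB' hle

/-- Under the constraints all slot costs are nonnegative, so later steps can use iterated Lebesgue
integrals without integrability conditions. -/
theorem Feasible.cost_eq {N : ℕ} {π : TxPolicy S} {x : ℝ} {s : S} (h : M.Feasible N π x s) :
    M.cost N π x s = (∫⁻ ω, M.pastCost N ω ∂(M.law π x s N)).toReal := by
  have hnn : ∀ᵐ ω ∂(M.law π x s N), ∀ i : Fin N, 0 ≤ M.α ^ (i : ℕ) * M.slotCost (ω i) := by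
    filter_upwards [h] with ω hω i
    exact mul_nonneg (pow_nonneg M.α_nonneg _) (Admissible.slotCost_nonneg (M := M) (hω i))
  have hmeas : Measurable fun ω : Fin N → TxSlot S =>
      ∑ i : Fin N, M.α ^ (i : ℕ) * M.slotCost (ω i) :=
    Finset.measurable_sum _ fun i _ =>
      (M.measurable_slotCost.comp (measurable_pi_apply i)).const_mul _
  change ∫ ω, ∑ i : Fin N, M.α ^ (i : ℕ) * M.slotCost (ω i) ∂(M.law π x s N) = _
  rw [integral_eq_lintegral_of_nonneg_ae _ hmeas.aestronglyMeasurable]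
  · congr 1
    refine lintegral_congr_ae ?_
    filter_upwards [hnn] with ω hω
    exact ENNReal.ofReal_sum_of_nonneg fun i _ => hω i
  · filter_upwards [hnn] with ω hω
    exact Finset.sum_nonneg fun i _ => hω i

/-! ### Switching to the base-stock rule after t slots -/

variable (M) in
/-- The discounted cost of the first `t` slots and the conditional expectation of the cost when the
base-stock policy is used in `m` further slots. -/
noncomputable def switchCost (x : ℝ) (s : S) (t m : ℕ) (ω : Fin t → TxSlot S) : ℝ≥0∞ :=
  M.pastCost t ω + ∫⁻ y, ENNReal.ofReal (M.α ^ t * M.value m y.2 y.1) ∂(M.stateKernel x s t ω)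

variable (M) in
theorem measurable_switchCost (x : ℝ) (s : S) (t m : ℕ) : Measurable (M.switchCost x s t m) :=
  (M.measurable_pastCost t).add
    (((M.measurable_value m).const_mul _).ennreal_ofReal.lintegral_kernel)

-- The vacuous average over the action gives the integral the same triple form as
-- `lintegral_law_succ`, so that the two can be compared pointwise.
omit [DiscreteMeasurableSpace S] in
theorem lintegral_switchCost (π : TxPolicy S) (x : ℝ) (s : S) (t m : ℕ) :
    ∫⁻ ω, M.switchCost x s t m ω ∂(M.law π x s t) = ∫⁻ ω, ∫⁻ y, ∫⁻ _,
      (M.pastCost t ω + ENNReal.ofReal (M.α ^ t * M.value m y.2 y.1)) ∂(π.act t (ω, y))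
        ∂(M.stateKernel x s t ω) ∂(M.law π x s t) := by
  have := π.markov t
  refine lintegral_congr fun ω => ?_
  simp only [lintegral_const, measure_univ, mul_one]
  rw [lintegral_add_left measurable_const, lintegral_const, measure_univ, mul_one, switchCost]

theorem OnGrid.switchCost_snoc (hM : M.OnGrid) (x : ℝ) (s : S) (t m : ℕ) (ω : Fin t → TxSlot S)
    {y : ℝ × S} {z : ℝ} (h : M.Admissible (y, z)) :
    M.switchCost x s (t + 1) m (Fin.snoc (α := fun _ => TxSlot S) ω (y, z)) =
      M.pastCost t ω + ENNReal.ofReal (M.α ^ t * (M.rate z y.2 + M.postValue m (y.1 + z))) := by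
  have hα := pow_nonneg M.α_nonneg t
  have hα' := pow_nonneg M.α_nonneg (t + 1)
  have hv := fun s' => hM.value_nonneg m s' h.next_nonneg
  rw [switchCost, pastCost_snoc, lintegral_stateKernel_succ _ _ _ _ _
    ((M.measurable_value m).const_mul _).ennreal_ofReal, Fin.snoc_last, add_assoc]
  congr 1
  have hp : ∀ s', M.p s' = ENNReal.ofReal (M.p s').toReal := fun s' =>
    (ENNReal.ofReal_toReal (M.p.apply_ne_top s')).symm
  have hsum : ∑ s', M.p s' * ENNReal.ofReal (M.α ^ (t + 1) * M.value m s' (y.1 + z - M.d)) =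
      ENNReal.ofReal (∑ s', (M.p s').toReal * (M.α ^ (t + 1) * M.value m s' (y.1 + z - M.d))) := by
    rw [ENNReal.ofReal_sum_of_nonneg fun s' _ =>
      mul_nonneg ENNReal.toReal_nonneg (mul_nonneg hα' (hv s'))]
    refine Finset.sum_congr rfl fun s' _ => ?_
    rw [ENNReal.ofReal_mul ENNReal.toReal_nonneg, ← hp]
  rw [hsum, ← ENNReal.ofReal_add (mul_nonneg hα h.slotCost_nonneg)
    (Finset.sum_nonneg fun s' _ => mul_nonneg ENNReal.toReal_nonneg (mul_nonneg hα' (hv s')))]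
  congr 1
  rw [slotCost, postValue, mul_add, mul_add, mul_add, add_assoc, Finset.mul_sum, Finset.mul_sum]
  congr 2
  refine Finset.sum_congr rfl fun s' _ => ?_
  ring

theorem lintegral_switchCost_zero (π : TxPolicy S) (x : ℝ) (s : S) (N : ℕ) :
    ∫⁻ ω, M.switchCost x s 0 N ω ∂(M.law π x s 0) = ENNReal.ofReal (M.value N s x) := by
  rw [law, lintegral_dirac' _ (M.measurable_switchCost x s 0 N), switchCost, stateKernel,
    Kernel.const_apply,
    lintegral_dirac' _ ((M.measurable_value N).const_mul _).ennreal_ofReal]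
  simp [pastCost]

omit [DiscreteMeasurableSpace S] in
theorem switchCost_last (x : ℝ) (s : S) (N : ℕ) (ω : Fin N → TxSlot S) :
    M.switchCost x s N 0 ω = M.pastCost N ω := by
  simp [switchCost, value]

/-- Integrated over slot t, the Bellman inequality says that postponing the switch by one slot does
not lower the cost. -/
theorem OnGrid.lintegral_switchCost_le (hM : M.OnGrid) {π : TxPolicy S} {x : ℝ} {s : S}
    (hx : 0 ≤ x) {t : ℕ} (h : M.Feasible (t + 1) π x s) (m : ℕ) :
    ∫⁻ ω, M.switchCost x s t (m + 1) ω ∂(M.law π x s t) ≤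
      ∫⁻ ω, M.switchCost x s (t + 1) m ω ∂(M.law π x s (t + 1)) := by
  rw [lintegral_switchCost, lintegral_law_succ _ _ _ _ _ (M.measurable_switchCost x s (t + 1) m)]
  obtain ⟨h1, h2⟩ := (feasible_succ_iff t π x s).1 h
  refine lintegral_mono_ae ?_
  filter_upwards [h2, h1.buffer_nonneg hx] with ω h3 h4
  refine lintegral_mono_ae ?_
  filter_upwards [h3, h4] with y h5 h6
  refine lintegral_mono_ae ?_
  filter_upwards [h5] with z h7
  rw [hM.switchCost_snoc x s t m ω h7]
  gcongr
  · exact pow_nonneg M.α_nonneg t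
  · exact hM.value_le m y.2 h6 ⟨h7.nonneg, h7.le_zMax⟩ (by linarith [h7.next_nonneg])

omit [DiscreteMeasurableSpace S] in
theorem OnGrid.act_eq (hM : M.OnGrid) {N : ℕ} {π : TxPolicy S} (h : M.FollowsBaseStock N π) {t m : ℕ}
    (ht : t + (m + 1) = N) (ω : Fin t → TxSlot S) {y : ℝ × S} (hy : 0 ≤ y.1) :
    π.act t (ω, y) = Measure.dirac (M.action (m + 1) y.2 y.1) := by
  have hm : N - t = m + 1 := by omega
  refine h t (by omega) ω y.1 y.2 _ hy ?_
  rw [hm]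
  exact hM.baseStock_action m y.2 hy

/-- The rule is prescribed only for nonnegative buffer levels; feasibility up to slot t supplies
this nonnegativity in slot t. -/
theorem OnGrid.feasible_of_follows (hM : M.OnGrid) {N : ℕ} {π : TxPolicy S}
    (h : M.FollowsBaseStock N π) {x : ℝ} (s : S) (hx : 0 ≤ x) {t : ℕ} (ht : t ≤ N) :
    M.Feasible t π x s := by
  induction t with
  | zero => exact Filter.Eventually.of_forall fun ω i => i.elim0
  | succ t ih =>
    have ih := ih (by omega)
    refine (feasible_succ_iff t π x s).2 ⟨ih, ?_⟩
    filter_upwards [ih.buffer_nonneg hx] with ω hω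
    filter_upwards [hω] with y hy
    obtain ⟨m, rfl⟩ := Nat.exists_eq_add_of_le ht
    rw [hM.act_eq h (m := m) (by omega) ω hy, ae_dirac_eq]
    exact hM.admissible_action m hy y.2

theorem OnGrid.lintegral_switchCost_eq (hM : M.OnGrid) {N : ℕ} {π : TxPolicy S}
    (h : M.FollowsBaseStock N π) {x : ℝ} (s : S) (hx : 0 ≤ x) {t m : ℕ} (ht : t + (m + 1) = N) :
    ∫⁻ ω, M.switchCost x s t (m + 1) ω ∂(M.law π x s t) =
      ∫⁻ ω, M.switchCost x s (t + 1) m ω ∂(M.law π x s (t + 1)) := by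
  rw [lintegral_switchCost, lintegral_law_succ _ _ _ _ _ (M.measurable_switchCost x s (t + 1) m)]
  refine lintegral_congr_ae ?_
  filter_upwards [(hM.feasible_of_follows h s hx (t := t) (by omega)).buffer_nonneg hx] with ω hω
  refine lintegral_congr_ae ?_
  filter_upwards [hω] with y hy
  rw [hM.act_eq h ht ω hy, lintegral_dirac, lintegral_dirac,
    hM.switchCost_snoc x s t m ω (hM.admissible_action m hy y.2), value_succ]

theorem OnGrid.lintegral_switchCost_le_last (hM : M.OnGrid) {π : TxPolicy S} {x : ℝ} {s : S}
    (hx : 0 ≤ x) (m : ℕ) : ∀ t, M.Feasible (t + m) π x s →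
      ∫⁻ ω, M.switchCost x s t m ω ∂(M.law π x s t) ≤
        ∫⁻ ω, M.pastCost (t + m) ω ∂(M.law π x s (t + m)) := by
  induction m with
  | zero =>
    intro t _
    simp only [switchCost_last]
    exact le_rfl
  | succ m ih =>
    intro t h
    rw [← add_assoc, add_right_comm] at *
    exact (hM.lintegral_switchCost_le hx (h.mono (by omega)) m).trans (ih (t + 1) h)

theorem OnGrid.lintegral_switchCost_eq_last (hM : M.OnGrid) {N : ℕ} {π : TxPolicy S}
    (h : M.FollowsBaseStock N π) {x : ℝ} (s : S) (hx : 0 ≤ x) (m : ℕ) : ∀ t, t + m = N →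
      ∫⁻ ω, M.switchCost x s t m ω ∂(M.law π x s t) =
        ∫⁻ ω, M.pastCost N ω ∂(M.law π x s N) := by
  induction m with
  | zero =>
    rintro t rfl
    simp only [switchCost_last]
    rfl
  | succ m ih =>
    intro t ht
    exact (hM.lintegral_switchCost_eq h s hx ht).trans (ih (t + 1) (by omega))

theorem OnGrid.isOptimal (hM : M.OnGrid) {N : ℕ} {π : TxPolicy S} (h : M.FollowsBaseStock N π) :
    M.IsOptimal N π := by
  intro x s hx
  have hf := hM.feasible_of_follows h s hx le_rfl
  refine ⟨hf, fun π' hf' => ?_⟩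
  rw [hf.cost_eq, hf'.cost_eq, ← hM.lintegral_switchCost_eq_last h s hx N 0 (zero_add N)]
  refine ENNReal.toReal_mono hf'.lintegral_pastCost_ne_top ?_
  have := hM.lintegral_switchCost_le_last (π := π') (s := s) hx N 0 (by rwa [zero_add])
  rw [zero_add] at this
  rwa [lintegral_switchCost_zero, ← lintegral_switchCost_zero π']

variable (M) in
/-- The finite generalized base-stock policy for `N` slots. -/
noncomputable def baseStockPolicy (N : ℕ) : TxPolicy S where
  act t := Kernel.deterministic (fun q => M.action (N - t) q.2.2 q.2.1)
    ((M.measurable_action (N - t)).comp measurable_snd)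
  markov _ := inferInstance

theorem OnGrid.follows_baseStockPolicy (hM : M.OnGrid) (N : ℕ) :
    M.FollowsBaseStock N (M.baseStockPolicy N) := by
  intro t ht ω x s z _ hz
  obtain ⟨n, hn⟩ : ∃ n, N - t = n + 1 := ⟨N - t - 1, by omega⟩
  rw [baseStockPolicy, Kernel.deterministic_apply]
  rw [hn] at hz ⊢
  rw [hM.eq_action hz]

end TxModel

theorem theorem4 {S : Type*} [Fintype S] [MeasurableSpace S] [DiscreteMeasurableSpace S]
    (M : TxModel S)
    (hbrk : ∀ s, ∀ k < M.K, ∃ l : ℕ, 1 ≤ l ∧ M.brk k s = l * M.d)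
    (hzMax : ∀ s, ∃ l : ℕ, 1 ≤ l ∧ M.zMax s = l * M.d) :
    -- each slope lies in exactly one band of thresholds, which determines the critical number
    (∀ n, 1 ≤ n → ∀ s, ∀ k ≤ M.K, (∃! j : ℕ, M.InBand n k s j) ∧
      ∀ j, M.InBand n k s j → M.crit n k s = j * M.d) ∧
    -- the critical numbers are nonincreasing in the segment
    (∀ n, 1 ≤ n → ∀ s, ∀ k < M.K, M.crit n (k + 1) s ≤ M.crit n k s) ∧
    -- the base-stock policy prescribes exactly one action in each state
    (∀ n, 1 ≤ n → ∀ s (x : ℝ), 0 ≤ x → ∃! z : ℝ, M.BaseStock n x s z) ∧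
    -- it is a policy, and it is optimal
    (∀ N : ℕ, (∃ π : TxPolicy S, M.FollowsBaseStock N π) ∧
      ∀ π : TxPolicy S, M.FollowsBaseStock N π → M.IsOptimal N π) ∧
    -- for linear power-rate curves it is the modified base-stock policy of the linear case
    (M.K = 0 → ∀ n, 1 ≤ n →
      (∀ j, 1 ≤ j → M.gamma n j = M.gammaLin n j) ∧
      ∀ s (x z : ℝ), 0 ≤ x → M.BaseStock n x s z →
        (M.crit n 0 s ≤ x → z = 0) ∧
        (M.crit n 0 s - M.P / M.slope 0 s ≤ x → x < M.crit n 0 s → z = M.crit n 0 s - x) ∧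
        (x < M.crit n 0 s - M.P / M.slope 0 s → z = M.P / M.slope 0 s)) := by
  have hM := M.onGrid hbrk hzMax
  refine ⟨fun n hn s k hk => ?_, fun n hn s k hk => ?_, fun n hn s x hx => ?_,
    fun N => ⟨⟨_, hM.follows_baseStockPolicy N⟩, fun π h => hM.isOptimal h⟩, fun hK n hn => ?_⟩
  all_goals obtain ⟨n, rfl⟩ := Nat.exists_eq_add_of_le' hn
  · exact ⟨hM.existsUnique_inBand n hk s, fun j hj => hM.crit_eq n hk s hj⟩
  · exact hM.crit_anti n s k (k + 1) k.le_succ (by omega)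
  · exact ⟨_, hM.baseStock_action n s hx, fun z hz => hM.eq_action hz⟩
  · refine ⟨hM.gamma_eq_gammaLin hK n, fun s x z _ hz => ?_⟩
    have hpos := M.zMax_pos s
    rw [hM.eq_action hz, M.action_of_linear hK, ← TxModel.zMax_eq_of_linear hK s]
    refine ⟨fun h => ?_, fun h1 h2 => ?_, fun h => ?_⟩
    · exact max_eq_left (min_le_of_right_le (by linarith))
    · rw [min_eq_right (by linarith), max_eq_right (by linarith)]
    · rw [min_eq_left (by linarith), max_eq_right hpos.le]
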